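/- Let $D\subset\mathbb C$ be the open unit disc and realise the universal covering group $\tilde{\mathrm{Sl}}(2,\mathbb R)$ as the manifold $\mathbb R\times D$ with the product $$(\alpha,z)\cdot(\beta,w)=\Bigl(\alpha+\beta-2\arg(1+\bar z e^{i\alpha}w),\ \frac{e^{i\alpha}w+z}{1+\bar z e^{i\alpha}w}\Bigr),$$ where $\arg$ is the principal argument (so that $(\alpha,z)$ covers the isometry $w\mapsto (e^{i\alpha}w+z)/(1+\bar z e^{i\alpha}w)$ of the hyperbolic disc) and the identity is $(0,0)$. Let $E_1,E_2,E_3$ be the left invariant vector fields which at the identity equal $\partial_\alpha$, $\tfrac12\partial_x$, $\tfrac12\partial_y$; they satisfy $[E_2,E_3]=-E_1$, $[E_3,E_1]=E_2$, $[E_1,E_2]=E_3$. Let $\mathcal D_s$ be the group of diffeomorphisms of $\tilde{\mathrm{Sl}}(2,\mathbb R)$ generated by the left translations and the three Lie group automorphisms whose differentials at the identity change the sign of two of the $E_i$ and fix the third. Let $\mathcal D_e$ be the group generated by $\mathcal D_s$ and the Lie group automorphisms whose differentials at the identity fix $E_1$ and rotate $(E_2,E_3)$ by some angle $\theta\in\mathbb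 R$. Let $g$ be a left invariant Riemannian metric and $k$ a left invariant symmetric covariant $2$-tensor on $\tilde{\mathrm{Sl}}(2,\mathbb R)$ satisfying Einstein's vacuum constraint equations $$R_g-k_{ij}k^{ij}+(\mathrm{tr}_g k)^2=0,\qquad \nabla_i\,\mathrm{tr}_g k-\nabla^jk_{ij}=0,$$ where $\nabla$ is the Levi-Civita connection and $R_g$ the scalar curvature of $g$. Assume that $g$ and $k$ are diagonal with respect to $E_1,E_2,E_3$. Let $\tilde E_i=c_iE_i$, $c_i>0$, be the $g$-orthonormal basis obtained by rescaling, let $\gamma_{ij}^k$ be its structure constants, $[\tilde E_i,\tilde E_j]=\gamma_{ij}^k\tilde E_k$, and let $n_i=n^{ii}$ and $k_i=k(\tilde E_i,\tilde E_i)$ be the diagonal components of $n^{ij}=\tfrac12\gamma^{(i}_{kl}\epsilon^{j)kl}$ (the parentheses denote the symmetric part, normalised so that $\gamma_{ij}^k=\epsilon_{ijm}n^{km}$) and of $k$. Let $\mathcal D(g,k)$ be the group of diffeomorphisms $\phi$ of $\tilde{\mathrm{Sl}}(2,\mathbb R)$ with $\phi^*g=g$ and $\phi^*k=k$. If $n_2=n_3$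 and $k_2=k_3$, then $\mathcal D(g,k)=\mathcal D_e$. Otherwise $\mathcal D(g,k)=\mathcal D_s$. -/

import Mathlib

open scoped Manifold ContDiff ComplexConjugate
open Bundle VectorField

noncomputable section

/-! ## The group `S̃l(2,ℝ)` on `ℝ × D` -/

/-- The open subset `ℝ × D` of `ℝ × ℂ`, where `D` is the open unit disc. -/
def lineTimesDisc : TopologicalSpace.Opens (ℝ × ℂ) :=
  ⟨{p | ‖p.2‖ < 1}, isOpen_lt (continuous_snd.norm) continuous_const⟩

/-- The universal covering group `S̃l(2,ℝ)`, realised on the simply connected manifold `ℝ × D`.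
The point `(α, z)` covers the orientation preserving isometry
`w ↦ (e^{iα} w + z) / (1 + z̄ e^{iα} w)` of the disc model of the hyperbolic plane, equivalently the
unit tangent vector at `z` whose angle with the `x`-axis is `α`. -/
abbrev SLTilde : Type := ↥lineTimesDisc

/-- The model with corners of the `3`-manifold `S̃l(2,ℝ)`. -/
abbrev modelSL : ModelWithCorners ℝ (ℝ × ℂ) (ℝ × ℂ) := 𝓘(ℝ, ℝ × ℂ)

namespace SLTilde

/-- The number `e^{iα}`. -/
def phase (a : ℝ) : ℂ := Complex.exp (a * Complex.I)

/-- The denominator `1 + z̄ e^{iα} w`. -/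
def den (p : ℝ × ℂ) (w : ℂ) : ℂ := 1 + conj p.2 * phase p.1 * w

/-- The isometry `w ↦ (e^{iα} w + z) / (1 + z̄ e^{iα} w)` of the disc covered by `(α, z)`. -/
def mobius (p : ℝ × ℂ) (w : ℂ) : ℂ := (phase p.1 * w + p.2) / den p w

/-- The product of `(α, z)` and `(β, w)`. The second component is the image of `w` under the isometry
covered by `(α, z)`; the first one is `β` plus the argument, chosen continuous in `w` and equal to
`α` at `w = 0`, of the derivative `e^{iα} (1 - |z|²) / (1 + z̄ e^{iα} w)²` of that isometry
at `w`. -/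
def mulAux (p q : ℝ × ℂ) : ℝ × ℂ :=
  (p.1 + q.1 - 2 * (den p q.2).arg, mobius p q.2)

lemma phase_mul_conj (a : ℝ) : phase a * conj (phase a) = 1 := by
  rw [Complex.mul_conj, Complex.normSq_eq_norm_sq]
  simp [phase, Complex.norm_exp_ofReal_mul_I]

lemma norm_phase (a : ℝ) : ‖phase a‖ = 1 := by
  simp [phase, Complex.norm_exp_ofReal_mul_I]

lemma phase_neg (a : ℝ) : phase (-a) = conj (phase a) := by
  simp [phase, ← Complex.exp_conj]

lemma den_re_pos {p : ℝ × ℂ} {w : ℂ} (hp : ‖p.2‖ < 1) (hw : ‖w‖ < 1) : 0 < (den p w).re := by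
  have h : ‖conj p.2 * phase p.1 * w‖ < 1 := by
    rw [norm_mul, norm_mul, norm_phase, mul_one, Complex.norm_conj]
    nlinarith [norm_nonneg p.2, norm_nonneg w]
  have h2 := (abs_lt.1 ((Complex.abs_re_le_norm _).trans_lt h)).1
  simp only [den, Complex.add_re, Complex.one_re]
  linarith

lemma den_ne_zero {p : ℝ × ℂ} {w : ℂ} (hp : ‖p.2‖ < 1) (hw : ‖w‖ < 1) : den p w ≠ 0 := by
  intro h
  have := den_re_pos hp hw
  simp [h] at this

lemma norm_mobius_lt {p : ℝ × ℂ} {w : ℂ} (hp : ‖p.2‖ < 1) (hw : ‖w‖ < 1) :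
    ‖mobius p w‖ < 1 := by
  have hd : 0 < ‖den p w‖ := norm_pos_iff.2 (den_ne_zero hp hw)
  rw [mobius, norm_div, div_lt_one hd]
  set v := phase p.1 * w with hv
  have hvn : ‖v‖ < 1 := by rw [hv, norm_mul, norm_phase, one_mul]; exact hw
  have key : Complex.normSq (1 + conj p.2 * v) - Complex.normSq (v + p.2)
      = (1 - Complex.normSq v) * (1 - Complex.normSq p.2) := by
    simp [Complex.normSq_apply]; ring
  have e : den p w = 1 + conj p.2 * v := by rw [den, hv]; ring
  rw [e]
  rw [Complex.normSq_eq_norm_sq, Complex.normSq_eq_norm_sq, Complex.normSq_eq_norm_sq,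
    Complex.normSq_eq_norm_sq] at key
  have h1 : 0 < 1 - ‖v‖ ^ 2 := by nlinarith [norm_nonneg v]
  have h2 : 0 < 1 - ‖p.2‖ ^ 2 := by nlinarith [norm_nonneg p.2]
  have := mul_pos h1 h2
  exact lt_of_pow_lt_pow_left₀ 2 (norm_nonneg _) (by linarith)

lemma phase_arg (d : ℂ) (hd : d ≠ 0) : phase (-(2 * d.arg)) = conj d / d := by
  have h1 : (‖d‖ : ℂ) * phase d.arg = d := Complex.norm_mul_exp_arg_mul_I d
  have h2 : (‖d‖ : ℂ) * conj (phase d.arg) = conj d := by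
    have := congrArg conj h1
    simpa using this
  have h3 : phase (-(2 * d.arg)) = conj (phase d.arg) * conj (phase d.arg) := by
    rw [← phase_neg, phase, phase, ← Complex.exp_add]
    congr 1; push_cast; ring
  rw [h3, eq_div_iff hd]
  have h4 := phase_mul_conj d.arg
  calc conj (phase d.arg) * conj (phase d.arg) * d
      = conj (phase d.arg) * conj (phase d.arg) * ((‖d‖ : ℂ) * phase d.arg) := by rw [h1]
    _ = (‖d‖ : ℂ) * conj (phase d.arg) * (phase d.arg * conj (phase d.arg)) := by ring
    _ = conj d := by rw [h4, h2, mul_one]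

lemma phase_mulAux {p q : ℝ × ℂ} (hp : ‖p.2‖ < 1) (hq : ‖q.2‖ < 1) :
    phase (mulAux p q).1 = phase p.1 * phase q.1 * (conj (den p q.2) / den p q.2) := by
  rw [← phase_arg _ (den_ne_zero hp hq)]
  simp only [mulAux, phase, ← Complex.exp_add]
  congr 1; push_cast; ring

/-- The cocycle identity for the denominators. -/
lemma den_mulAux {p q : ℝ × ℂ} {u : ℂ} (hp : ‖p.2‖ < 1) (hq : ‖q.2‖ < 1) (hu : ‖u‖ < 1) :
    den p (mobius q u) * den q u = den (mulAux p q) u * den p q.2 := by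
  have h1 := den_ne_zero hp hq
  have h2 := den_ne_zero hq hu
  have h1' : conj (den p q.2) ≠ 0 := (map_ne_zero _).2 h1
  have e1 : den (mulAux p q) u
      = 1 + (conj (phase p.1) * conj q.2 + conj p.2) / conj (den p q.2)
        * (phase p.1 * phase q.1 * (conj (den p q.2) / den p q.2)) * u := by
    rw [den, phase_mulAux hp hq]
    simp [mulAux, mobius]
  have e2 : den (mulAux p q) u * den p q.2
      = den p q.2 + (conj q.2 * (phase p.1 * conj (phase p.1)) + conj p.2 * phase p.1)
        * phase q.1 * u := by
    rw [e1]; field_simp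
  rw [e2, phase_mul_conj]
  have e3 : den p (mobius q u) * den q u
      = den q u + conj p.2 * phase p.1 * (phase q.1 * u + q.2) := by
    rw [den, mobius]; field_simp
  rw [e3, den, den]; ring

/-- The product covers the composition of isometries. -/
lemma mobius_mulAux {p q : ℝ × ℂ} {u : ℂ} (hp : ‖p.2‖ < 1) (hq : ‖q.2‖ < 1) (hu : ‖u‖ < 1) :
    mobius (mulAux p q) u = mobius p (mobius q u) := by
  have h1 := den_ne_zero hp hq
  have h2 := den_ne_zero hq hu
  have hm := norm_mobius_lt hq hu
  have h3 := den_ne_zero hp hm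
  have h4 : den (mulAux p q) u ≠ 0 := den_ne_zero (norm_mobius_lt hp hq) hu
  have hc := den_mulAux hp hq hu
  have e1 : (phase (mulAux p q).1 * u + (mulAux p q).2) * den p q.2
      = phase p.1 * phase q.1 * conj (den p q.2) * u + (phase p.1 * q.2 + p.2) := by
    rw [phase_mulAux hp hq]
    simp only [mulAux, mobius]
    field_simp
  have e2 : (phase p.1 * mobius q u + p.2) * den q u
      = phase p.1 * (phase q.1 * u + q.2) + p.2 * den q u := by
    rw [mobius]; field_simp
  have e3 : (phase (mulAux p q).1 * u + (mulAux p q).2) * den p q.2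
      = (phase p.1 * mobius q u + p.2) * den q u := by
    rw [e1, e2]
    have := phase_mul_conj p.1
    simp only [den, map_add, map_mul, map_one, Complex.conj_conj]
    linear_combination (phase q.1 * u * p.2 * conj q.2) * this
  rw [mobius, mobius, div_eq_div_iff h4 h3]
  have h5 : den p q.2 * den q u ≠ 0 := mul_ne_zero h1 h2
  apply mul_right_cancel₀ h5
  linear_combination (den p (mobius q u) * den q u) * e3
    + (phase p.1 * mobius q u + p.2) * den q u * hc

lemma arg_add_of_re_pos {a b : ℂ} (ha : 0 < a.re) (hb : 0 < b.re) :
    (a * b).arg = a.arg + b.arg := by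
  have ha0 : a ≠ 0 := by rintro rfl; simp at ha
  have hb0 : b ≠ 0 := by rintro rfl; simp at hb
  have h1 := abs_lt.1 (Complex.abs_arg_lt_pi_div_two_iff.2 (Or.inl ha))
  have h2 := abs_lt.1 (Complex.abs_arg_lt_pi_div_two_iff.2 (Or.inl hb))
  exact Complex.arg_mul ha0 hb0 ⟨by linarith [h1.1, h2.1], by linarith [h1.2, h2.2]⟩

lemma mulAux_assoc {p q r : ℝ × ℂ} (hp : ‖p.2‖ < 1) (hq : ‖q.2‖ < 1) (hr : ‖r.2‖ < 1) :
    mulAux (mulAux p q) r = mulAux p (mulAux q r) := by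
  refine Prod.ext ?_ (mobius_mulAux hp hq hr)
  have hc := congrArg Complex.arg (den_mulAux hp hq hr)
  rw [arg_add_of_re_pos (den_re_pos hp (norm_mobius_lt hq hr)) (den_re_pos hq hr),
    arg_add_of_re_pos (den_re_pos (norm_mobius_lt hp hq) hr) (den_re_pos hp hq)] at hc
  change p.1 + q.1 - 2 * (den p q.2).arg + r.1 - 2 * (den (mulAux p q) r.2).arg
    = p.1 + (q.1 + r.1 - 2 * (den q r.2).arg) - 2 * (den p (mobius q r.2)).arg
  linarith

instance : Mul SLTilde := ⟨fun p q => ⟨mulAux p.1 q.1, norm_mobius_lt p.2 q.2⟩⟩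

instance : One SLTilde := ⟨⟨(0, 0), by simp [lineTimesDisc]⟩⟩

instance : Inv SLTilde :=
  ⟨fun p => ⟨(-p.1.1, -(phase (-p.1.1) * p.1.2)), by
    have h : ‖p.1.2‖ < 1 := p.2
    change ‖-(phase (-p.1.1) * p.1.2)‖ < 1
    rwa [norm_neg, norm_mul, norm_phase, one_mul]⟩⟩

lemma coe_mul (p q : SLTilde) : ((p * q : SLTilde) : ℝ × ℂ) = mulAux p q := rfl
lemma coe_one : ((1 : SLTilde) : ℝ × ℂ) = (0, 0) := rfl
lemma coe_inv (p : SLTilde) :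
    ((p⁻¹ : SLTilde) : ℝ × ℂ) = (-p.1.1, -(phase (-p.1.1) * p.1.2)) := rfl

instance : Group SLTilde :=
  Group.ofLeftAxioms
    (fun p q r => Subtype.ext (mulAux_assoc p.2 q.2 r.2))
    (fun p => Subtype.ext (by
      rw [coe_mul, coe_one]
      simp [mulAux, mobius, den, phase]))
    (fun p => Subtype.ext (by
      have hz : ‖p.1.2‖ < 1 := p.2
      have hpos : (0 : ℝ) < 1 - Complex.normSq p.1.2 := by
        rw [Complex.normSq_eq_norm_sq]; nlinarith [norm_nonneg p.1.2]
      have hden : den (-p.1.1, -(phase (-p.1.1) * p.1.2)) p.1.2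
          = ((1 - Complex.normSq p.1.2 : ℝ) : ℂ) := by
        have h := phase_mul_conj (-p.1.1)
        simp only [den, map_neg, map_mul]
        push_cast
        rw [← Complex.mul_conj]
        linear_combination (-(conj p.1.2 * p.1.2)) * h
      rw [coe_mul, coe_one, coe_inv]
      simp only [mulAux, mobius, hden, Complex.arg_ofReal_of_nonneg hpos.le]
      simp))

lemma contDiff_phase : ContDiff ℝ ∞ phase := by
  unfold phase
  exact ((Complex.ofRealCLM.contDiff).mul contDiff_const).cexp

lemma contDiff_den : ContDiff ℝ ∞ fun x : (ℝ × ℂ) × (ℝ × ℂ) => den x.1 x.2.2 := by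
  unfold den
  have h1 : ContDiff ℝ ∞ fun x : (ℝ × ℂ) × (ℝ × ℂ) => conj x.1.2 :=
    Complex.conjCLE.contDiff.comp (contDiff_snd.comp contDiff_fst)
  have h2 : ContDiff ℝ ∞ fun x : (ℝ × ℂ) × (ℝ × ℂ) => phase x.1.1 :=
    contDiff_phase.comp (contDiff_fst.comp contDiff_fst)
  exact contDiff_const.add ((h1.mul h2).mul (contDiff_snd.comp contDiff_snd))

lemma contDiffAt_mulAux (x : (ℝ × ℂ) × (ℝ × ℂ)) (h1 : ‖x.1.2‖ < 1) (h2 : ‖x.2.2‖ < 1) :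
    ContDiffAt ℝ ∞ (fun x : (ℝ × ℂ) × (ℝ × ℂ) => mulAux x.1 x.2) x := by
  have hd := (contDiff_den.contDiffAt (x := x))
  have hlog : ContDiffAt ℝ ∞ (fun x : (ℝ × ℂ) × (ℝ × ℂ) => Complex.log (den x.1 x.2.2)) x := by
    have := (Complex.contDiffAt_log (n := ∞) (x := den x.1 x.2.2)
      (Or.inl (den_re_pos h1 h2))).restrict_scalars ℝ
    exact this.comp x hd
  have harg : ContDiffAt ℝ ∞ (fun x : (ℝ × ℂ) × (ℝ × ℂ) => (den x.1 x.2.2).arg) x := by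
    have := (Complex.imCLM.contDiff (n := ∞)).contDiffAt.comp x hlog
    refine this.congr_of_eventuallyEq (Filter.Eventually.of_forall fun y => ?_)
    simp [Complex.log_im]
  have hp : ContDiff ℝ ∞ fun x : (ℝ × ℂ) × (ℝ × ℂ) => phase x.1.1 :=
    contDiff_phase.comp (contDiff_fst.comp contDiff_fst)
  refine ContDiffAt.prodMk ?_ ?_
  · exact (((contDiff_fst.comp contDiff_fst).add
      (contDiff_fst.comp contDiff_snd)).contDiffAt).sub (contDiffAt_const.mul harg)
  · exact ((hp.mul (contDiff_snd.comp contDiff_snd)).add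
      (contDiff_snd.comp contDiff_fst)).contDiffAt.mul (hd.inv (den_ne_zero h1 h2))

instance : LieGroup modelSL ∞ SLTilde where
  contMDiff_mul := by
    rw [← ContMDiff.subtypeVal_comp_iff]
    intro x
    have h := (contDiffAt_mulAux ((x.1 : ℝ × ℂ), (x.2 : ℝ × ℂ)) x.1.2 x.2.2).contMDiffAt
    rw [modelWithCornersSelf_prod, ← chartedSpaceSelf_prod] at h
    have hv : ContMDiffAt (modelSL.prod modelSL) (modelSL.prod modelSL) ∞
        (fun y : SLTilde × SLTilde => ((y.1 : ℝ × ℂ), (y.2 : ℝ × ℂ))) x :=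
      ((contMDiff_subtype_val.comp contMDiff_fst).prodMk
        (contMDiff_subtype_val.comp contMDiff_snd)).contMDiffAt
    exact ContMDiffAt.comp (g := fun y : (ℝ × ℂ) × (ℝ × ℂ) => mulAux y.1 y.2) x h hv
  contMDiff_inv := by
    rw [← ContMDiff.subtypeVal_comp_iff]
    have h : ContDiff ℝ ∞ fun p : ℝ × ℂ => ((-p.1, -(phase (-p.1) * p.2)) : ℝ × ℂ) :=
      contDiff_fst.neg.prodMk ((contDiff_phase.comp contDiff_fst.neg).mul contDiff_snd).neg
    exact h.contMDiff.comp contMDiff_subtype_val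

end SLTilde

/-! ## Left invariant frames and tensors -/

/-- The Lie algebra of `S̃l(2,ℝ)`, the tangent space at the identity `(0, 0)`. -/
abbrev LieSL : Type := GroupLieAlgebra modelSL SLTilde

/-- Vector fields on `S̃l(2,ℝ)`. -/
abbrev VField : Type := (x : SLTilde) → TangentSpace modelSL x

/-- Covariant `2`-tensor fields on `S̃l(2,ℝ)`. -/
abbrev CovTensor : Type :=
  (x : SLTilde) → TangentSpace modelSL x →L[ℝ] TangentSpace modelSL x →L[ℝ] ℝ

/-- Smooth Riemannian metrics on `S̃l(2,ℝ)`. -/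
abbrev MetricSL : Type _ :=
  ContMDiffRiemannianMetric modelSL ∞ (ℝ × ℂ) (fun x : SLTilde => TangentSpace modelSL x)

/-- The standard basis of the Lie algebra: `∂_α`, `½ ∂_x`, `½ ∂_y` at the identity
(the velocities at `t = 0` of `(t, 0)`, `(0, t/2)` and `(0, it/2)`). -/
def stdBasis : Fin 3 → LieSL :=
  ![((1, 0) : ℝ × ℂ), ((0, 1 / 2) : ℝ × ℂ), ((0, Complex.I / 2) : ℝ × ℂ)]

/-- The left invariant vector fields `E_i` extending the standard basis. -/
def stdFrame (i : Fin 3) : VField := mulInvariantVectorField (stdBasis i)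

/-- The pull-back `φ^* h` of a covariant `2`-tensor field, evaluated on two tangent vectors. -/
def pullbackEval (φ : SLTilde → SLTilde) (h : CovTensor) (x : SLTilde)
    (v w : TangentSpace modelSL x) : ℝ :=
  h (φ x) (mfderiv modelSL modelSL φ x v) (mfderiv modelSL modelSL φ x w)

/-- `φ^* h = h`. -/
def Preserves (φ : SLTilde → SLTilde) (h : CovTensor) : Prop :=
  ∀ (x : SLTilde) (v w : TangentSpace modelSL x), pullbackEval φ h x v w = h x v w

/-- Invariance under all left translations. -/
def IsLeftInvariant (h : CovTensor) : Prop :=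
  ∀ a : SLTilde, Preserves (fun x => a * x) h

/-- Symmetry of a covariant `2`-tensor field. -/
def IsSymmTensor (h : CovTensor) : Prop :=
  ∀ (x : SLTilde) (v w : TangentSpace modelSL x), h x v w = h x w v

/-- Diagonality with respect to the frame `E_i`. -/
def IsDiagonal (h : CovTensor) : Prop :=
  ∀ (x : SLTilde) (i j : Fin 3), i ≠ j → h x (stdFrame i x) (stdFrame j x) = 0

/-! ## Einstein's constraint equations -/

/-- Covariant derivatives on the tangent bundle of `S̃l(2,ℝ)`. -/
abbrev ConnectionSL : Type _ :=
  CovariantDerivative modelSL (ℝ × ℂ) (fun x : SLTilde => TangentSpace modelSL x)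

/-- The vector field `∇_X Y`. -/
def covD (nab : ConnectionSL) (X Y : VField) : VField := fun x => nab Y x (X x)

/-- The derivative `X f` of a function along a vector field. -/
def dirD (X : VField) (f : SLTilde → ℝ) (x : SLTilde) : ℝ :=
  (mfderiv modelSL 𝓘(ℝ, ℝ) f x : TangentSpace modelSL x →L[ℝ] ℝ) (X x)

/-- `∇` is the Levi-Civita connection of `g`: it is torsion free, and
`X g(Y, Z) = g(∇_X Y, Z) + g(Y, ∇_X Z)` for all `X` and all differentiable `Y`, `Z`. -/
def IsLeviCivita (g : MetricSL) (nab : ConnectionSL) : Prop :=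
  nab.torsion = 0 ∧
    ∀ (x : SLTilde) (X Y Z : VField),
      MDifferentiableAt modelSL modelSL.tangent
        (fun y => (⟨y, Y y⟩ : TangentBundle modelSL SLTilde)) x →
      MDifferentiableAt modelSL modelSL.tangent
        (fun y => (⟨y, Z y⟩ : TangentBundle modelSL SLTilde)) x →
      dirD X (fun y => g.inner y (Y y) (Z y)) x
        = g.inner x (covD nab X Y x) (Z x) + g.inner x (Y x) (covD nab X Z x)

/-- The curvature `R(X, Y) Z = ∇_X ∇_Y Z - ∇_Y ∇_X Z - ∇_{[X, Y]} Z`. -/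
def curv (nab : ConnectionSL) (X Y Z : VField) : VField := fun x =>
  covD nab X (covD nab Y Z) x - covD nab Y (covD nab X Z) x
    - covD nab (mlieBracket modelSL X Y) Z x

/-- The covariant derivative `(∇_X h)(Y, Z) = X h(Y, Z) - h(∇_X Y, Z) - h(Y, ∇_X Z)`. -/
def covDTensor (nab : ConnectionSL) (h : CovTensor) (X Y Z : VField) (x : SLTilde) : ℝ :=
  dirD X (fun y => h y (Y y) (Z y)) x - h x (covD nab X Y x) (Z x) - h x (Y x) (covD nab X Z x)

/-- The components `g^{ij}` of the inverse metric with respect to the frame `E_i`. -/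
def invMetric (g : MetricSL) (x : SLTilde) : Matrix (Fin 3) (Fin 3) ℝ :=
  (Matrix.of fun i j => g.inner x (stdFrame i x) (stdFrame j x))⁻¹

/-- The trace `tr_g k = g^{ij} k_{ij}`. -/
def traceTensor (g : MetricSL) (k : CovTensor) (x : SLTilde) : ℝ :=
  ∑ i, ∑ j, invMetric g x i j * k x (stdFrame i x) (stdFrame j x)

/-- The squared norm `k_{ij} k^{ij} = g^{il} g^{jm} k_{ij} k_{lm}`. -/
def normSqTensor (g : MetricSL) (k : CovTensor) (x : SLTilde) : ℝ :=
  ∑ i, ∑ j, ∑ l, ∑ m, invMetric g x i l * invMetric g x j m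
    * k x (stdFrame i x) (stdFrame j x) * k x (stdFrame l x) (stdFrame m x)

/-- The scalar curvature `g^{il} g^{jm} g(R(E_i, E_j) E_m, E_l)`. -/
def scalarCurv (g : MetricSL) (nab : ConnectionSL) (x : SLTilde) : ℝ :=
  ∑ i, ∑ j, ∑ l, ∑ m, invMetric g x i l * invMetric g x j m
    * g.inner x (curv nab (stdFrame i) (stdFrame j) (stdFrame m) x) (stdFrame l x)

/-- The divergence `∇^j k_{ij} = g^{jl} (∇_{E_l} k)(E_i, E_j)`. -/
def divTensor (g : MetricSL) (nab : ConnectionSL) (k : CovTensor) (i : Fin 3) (x : SLTilde) : ℝ :=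
  ∑ j, ∑ l, invMetric g x j l * covDTensor nab k (stdFrame l) (stdFrame i) (stdFrame j) x

/-- Einstein's vacuum constraint equations `R_g - k_{ij} k^{ij} + (tr_g k)² = 0` and
`∇_i tr_g k - ∇^j k_{ij} = 0`, where `∇` is the Levi-Civita connection of `g`. -/
def SatisfiesConstraints (g : MetricSL) (k : CovTensor) : Prop :=
  ∃ nab : ConnectionSL, IsLeviCivita g nab ∧
    (∀ x, scalarCurv g nab x - normSqTensor g k x + traceTensor g k x ^ 2 = 0) ∧
    ∀ (i : Fin 3) (x : SLTilde),
      dirD (stdFrame i) (traceTensor g k) x - divTensor g nab k i x = 0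

/-! ## The matrix `n` of a basis of the Lie algebra -/

/-- The permutation symbol on three indices. -/
def levi (i j k : Fin 3) : ℝ :=
  Matrix.det (Matrix.of fun a b : Fin 3 => if (![i, j, k] : Fin 3 → Fin 3) a = b then (1 : ℝ) else 0)

/-- The structure constants `γ_{ij}^k` of a basis, `[b_i, b_j] = γ_{ij}^k b_k`. -/
def structConst (b : Module.Basis (Fin 3) ℝ LieSL) (i j k : Fin 3) : ℝ := b.repr ⁅b i, b j⁆ k

/-- The symmetric matrix `n^{ij} = ½ γ^{(i}_{kl} ε^{j)kl}`; on a unimodular Lie algebra it is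
characterised by `γ_{ij}^k = ε_{ijm} n^{km}`. -/
def nMatrix (b : Module.Basis (Fin 3) ℝ LieSL) : Matrix (Fin 3) (Fin 3) ℝ := fun i j =>
  (1 / 2) * ∑ k, ∑ l, (structConst b k l i * levi j k l + structConst b k l j * levi i k l) / 2

/-! ## Groups of diffeomorphisms -/

/-- Diffeomorphisms of `S̃l(2,ℝ)`. -/
abbrev DiffeoSL : Type := Diffeomorph modelSL modelSL SLTilde SLTilde ∞

/-- The diffeomorphisms form a group under composition. -/
instance : Group DiffeoSL where
  mul φ ψ := ψ.trans φ
  one := Diffeomorph.refl modelSL SLTilde ∞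
  inv φ := φ.symm
  mul_assoc _ _ _ := rfl
  one_mul _ := rfl
  mul_one _ := rfl
  inv_mul_cancel φ := Diffeomorph.ext fun x => φ.symm_apply_apply x

lemma diffeoSL_mul_apply (φ ψ : DiffeoSL) (x : SLTilde) : (φ * ψ) x = φ (ψ x) := rfl

lemma preserves_comp {h : CovTensor} (φ ψ : DiffeoSL) (hφ : Preserves φ h) (hψ : Preserves ψ h) :
    Preserves (⇑(φ * ψ)) h := by
  intro x v w
  have e : mfderiv modelSL modelSL (φ * ψ : DiffeoSL) x
      = (mfderiv modelSL modelSL φ (ψ x)).comp (mfderiv modelSL modelSL ψ x) :=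
    mfderiv_comp x (φ.mdifferentiable (by simp) _) (ψ.mdifferentiable (by simp) _)
  rw [pullbackEval, e]
  exact (hφ (ψ x) _ _).trans (hψ x v w)

lemma preserves_id (h : CovTensor) : Preserves (1 : DiffeoSL) h := by
  intro x v w
  have e : mfderiv modelSL modelSL (1 : DiffeoSL) x
      = ContinuousLinearMap.id ℝ (TangentSpace modelSL x) := mfderiv_id
  rw [pullbackEval, e]
  rfl

lemma preserves_inv {h : CovTensor} (φ : DiffeoSL) (hφ : Preserves φ h) :
    Preserves (φ⁻¹ : DiffeoSL) h := by
  intro x v w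
  have h1 := hφ ((φ⁻¹ : DiffeoSL) x) (mfderiv modelSL modelSL (φ⁻¹ : DiffeoSL) x v)
    (mfderiv modelSL modelSL (φ⁻¹ : DiffeoSL) x w)
  have e : mfderiv modelSL modelSL (φ * φ⁻¹ : DiffeoSL) x
      = (mfderiv modelSL modelSL φ ((φ⁻¹ : DiffeoSL) x)).comp
        (mfderiv modelSL modelSL (φ⁻¹ : DiffeoSL) x) :=
    mfderiv_comp x (φ.mdifferentiable (by simp) _)
      ((φ⁻¹ : DiffeoSL).mdifferentiable (by simp) _)
  have h2 := preserves_id h x v w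
  rw [← mul_inv_cancel φ, pullbackEval, e] at h2
  exact h1.symm.trans h2

/-- The group `𝒟(g, k)` of diffeomorphisms `φ` with `φ^* g = g` and `φ^* k = k`. -/
def isometryGroup (g : MetricSL) (k : CovTensor) : Subgroup DiffeoSL where
  carrier := {φ | Preserves φ g.inner ∧ Preserves φ k}
  mul_mem' hφ hψ := ⟨preserves_comp _ _ hφ.1 hψ.1, preserves_comp _ _ hφ.2 hψ.2⟩
  one_mem' := ⟨preserves_id _, preserves_id _⟩
  inv_mem' hφ := ⟨preserves_inv _ hφ.1, preserves_inv _ hφ.2⟩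

/-- The left translation `x ↦ a x`. -/
def leftTranslation (a : SLTilde) : DiffeoSL where
  toEquiv := Equiv.mulLeft a
  contMDiff_toFun := contMDiff_mul_left
  contMDiff_invFun := contMDiff_mul_left

/-- `ψ` is a Lie group automorphism whose differential at the identity maps `E_i` to
`A_{i1} E_1 + A_{i2} E_2 + A_{i3} E_3`. -/
def IsAutomorphismWith (A : Matrix (Fin 3) (Fin 3) ℝ) (ψ : DiffeoSL) : Prop :=
  (∀ x y : SLTilde, ψ (x * y) = ψ x * ψ y) ∧
    ∀ i : Fin 3, mfderiv modelSL modelSL ψ 1 (stdFrame i 1) = ∑ j, A i j • stdFrame j (ψ 1)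

/-- The diagonal matrix with a plus sign in place `i` and two minus signs. -/
def flipMatrix (i : Fin 3) : Matrix (Fin 3) (Fin 3) ℝ :=
  Matrix.diagonal fun j => if j = i then 1 else -1

/-- The rotation by the angle `θ` which fixes the first basis vector. -/
def rotMatrix (θ : ℝ) : Matrix (Fin 3) (Fin 3) ℝ :=
  !![1, 0, 0; 0, Real.cos θ, Real.sin θ; 0, -Real.sin θ, Real.cos θ]

/-- The group `𝒟_s` generated by the left translations and the three automorphisms which change
the sign of two of the `E_i` and fix the third. -/
def groupDs : Subgroup DiffeoSL :=
  Subgroup.closure (Set.range leftTranslation ∪ {ψ | ∃ i, IsAutomorphismWith (flipMatrix i) ψ})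

/-- The group `𝒟_e` generated by `𝒟_s` and the automorphisms which fix `E_1` and rotate
`E_2, E_3` by some angle. -/
def groupDe : Subgroup DiffeoSL :=
  Subgroup.closure ((groupDs : Set DiffeoSL) ∪ {ψ | ∃ θ, IsAutomorphismWith (rotMatrix θ) ψ})

end

/-!
Let `φ` preserve `g`. In the `g`-orthonormal left invariant frame `b_i = c_i E_i`, where `i` is
taken modulo `3`, with `[b_i, b_{i+1}] = n_{i+2} b_{i+2}`, the differential of `φ` is a function `A`
with values in the orthogonal group, and `ε = det A = ±1` is constant. Since `φ` maps brackets of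
vector fields to brackets, `A` satisfies a structure equation (`frameMatrix_structure_equation`).
Because `A` is orthogonal this determines all derivatives of `A`: with
`μ_i = (n_{i+1} + n_{i+2} - n_i) / 2`, `M = diag μ` and `S = ε A M Aᵀ`, the derivative `(b_i A) Aᵀ`
is the cross product with `(S - M) e_i` (`map_derivation_eq_crossMatrix_mul`). The integrability
condition of this system is `adj S = adj M`, the invariance of the Ricci tensor `2 adj M`
(`adjugate_eq_of_derivation_comm`). Differentiating it once more shows that the Ricci tensor
commutes with the cross product with `(S - M) e_i` (`curvature_diff_mul_eq_zero`). For `S̃l(2,ℝ)`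
one has `n_0 < 0 < n_1, n_2`, the curvature is never constant, and these equations force `S = M`.
Hence `A` is constant (`exists_const_frameMatrix`).

A diffeomorphism which maps every left invariant field to itself is a left translation, because
`φ(x) x⁻¹` has zero derivative (`eq_leftMul_of_frameMap_eq`). So `φ` is determined by `A` up to left
translations (`mem_of_hasFrameMatrix`). From `A M = ε M A` and the signs of the `μ_i` one gets
`ε = 1` and that `A` fixes the first axis; in the same way `A` commutes with the matrix of `k`. If
`n_1 ≠ n_2` or `k_1 ≠ k_2` then `A` is diagonal, so it is the identity or changes two signs;
otherwise `A` is a rotation about the first axis or the product of such a rotation and a sign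
change. The rotations and sign changes are realised by the automorphisms `(α, z) ↦ (α, e^{iθ} z)`
and `(α, z) ↦ (-α, z̄)`.

Conversely, a diffeomorphism with constant differential `A` preserves a left invariant tensor with
diagonal matrix `K` as soon as `A K Aᵀ = K` (`HasFrameMatrix.preserves`).
-/

noncomputable section

namespace SLTilde

/-! ### Left invariant fields in the coordinates of `ℝ × ℂ` -/

section Coordinates

open Classical in
/-- A retraction of `ℝ × ℂ` onto `ℝ × D`, with junk value `(0, 0)` outside `ℝ × D`. -/
def retract (p : ℝ × ℂ) : SLTilde := if h : p ∈ lineTimesDisc then ⟨p, h⟩ else 1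

lemma retract_coe (x : SLTilde) : retract (x : ℝ × ℂ) = x := by
  simp [retract]

lemma coe_retract {p : ℝ × ℂ} (h : p ∈ lineTimesDisc) : (retract p : ℝ × ℂ) = p := by
  simp [retract, h]

lemma lineTimesDisc_mem_nhds (x : SLTilde) : (lineTimesDisc : Set (ℝ × ℂ)) ∈ nhds (x : ℝ × ℂ) :=
  lineTimesDisc.isOpen.mem_nhds x.2

lemma coe_retract_eventuallyEq (x : SLTilde) :
    (fun p => (retract p : ℝ × ℂ)) =ᶠ[nhds (x : ℝ × ℂ)] id :=
  Filter.eventuallyEq_of_mem (lineTimesDisc_mem_nhds x) fun _ hp => coe_retract hp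

lemma contMDiffAt_retract (x : SLTilde) : ContMDiffAt modelSL modelSL ∞ retract (x : ℝ × ℂ) := by
  rw [← ContMDiffAt.subtypeVal_comp_iff]
  exact contMDiffAt_id.congr_of_eventuallyEq (coe_retract_eventuallyEq x)

/-- The inclusion of `ℝ × D` into `ℝ × ℂ`, as a map between manifolds. -/
def incl : SLTilde → ℝ × ℂ := Subtype.val

lemma contMDiff_incl : ContMDiff modelSL modelSL ∞ incl := contMDiff_subtype_val

lemma mdifferentiableAt_retract (x : SLTilde) :
    MDifferentiableAt modelSL modelSL retract (incl x) :=
  (contMDiffAt_retract x).mdifferentiableAt (by simp)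

lemma mdifferentiable_incl : MDifferentiable modelSL modelSL incl :=
  contMDiff_incl.mdifferentiable (by simp)

lemma hasMFDerivAt_incl (x : SLTilde) :
    HasMFDerivAt modelSL modelSL incl x (ContinuousLinearMap.id ℝ (ℝ × ℂ)) := by
  refine ⟨continuous_subtype_val.continuousAt, ?_⟩
  have h1 : writtenInExtChartAt modelSL modelSL x incl =ᶠ[nhds (x : ℝ × ℂ)] id := by
    have := TopologicalSpace.Opens.chartAt_subtype_val_symm_eventuallyEq
      (H := ℝ × ℂ) lineTimesDisc (x := x)
    filter_upwards [this] with p hp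
    exact hp.symm
  exact (HasFDerivAt.congr_of_eventuallyEq (hasFDerivAt_id (x : ℝ × ℂ)) h1).hasFDerivWithinAt

lemma mfderiv_incl (x : SLTilde) :
    mfderiv modelSL modelSL incl x = ContinuousLinearMap.id ℝ (ℝ × ℂ) :=
  (hasMFDerivAt_incl x).mfderiv

variable {F : Type*} [NormedAddCommGroup F] [NormedSpace ℝ F]

lemma mfderiv_eq_fderiv_retract (f : SLTilde → F) (x : SLTilde)
    (hf : MDifferentiableAt modelSL 𝓘(ℝ, F) f x) :
    mfderiv modelSL 𝓘(ℝ, F) f x = fderiv ℝ (f ∘ retract) (x : ℝ × ℂ) := by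
  have e : f = (f ∘ retract) ∘ incl := by
    funext y; simp [incl, retract_coe]
  have hr : retract (incl x) = x := retract_coe x
  have h1 : MDifferentiableAt modelSL 𝓘(ℝ, F) (f ∘ retract) (incl x) := by
    have := mdifferentiableAt_retract x
    refine MDifferentiableAt.comp (I' := modelSL) (incl x) ?_ this
    rwa [hr]
  conv_lhs => rw [e]
  rw [mfderiv_comp x h1 (mdifferentiable_incl x), mfderiv_incl, mfderiv_eq_fderiv]
  rfl

lemma contDiffAt_comp_retract {n : ℕ∞ω} (hn : n ≤ ∞) (f : SLTilde → F) (x : SLTilde)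
    (hf : ContMDiffAt modelSL 𝓘(ℝ, F) n f x) : ContDiffAt ℝ n (f ∘ retract) (x : ℝ × ℂ) := by
  rw [← contMDiffAt_iff_contDiffAt]
  refine ContMDiffAt.comp (I' := modelSL) (x : ℝ × ℂ) ?_ ((contMDiffAt_retract x).of_le hn)
  rwa [retract_coe]

/-- The left invariant vector field with value `v` at the identity, as a vector field on `ℝ × ℂ`. -/
def leftField (v p : ℝ × ℂ) : ℝ × ℂ :=
  (v.1 - 2 * (conj p.2 * phase p.1 * v.2).im, phase p.1 * v.2 * (1 - p.2 * conj p.2))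

lemma contDiff_leftField (v : ℝ × ℂ) : ContDiff ℝ ∞ (leftField v) := by
  have hp : ContDiff ℝ ∞ fun p : ℝ × ℂ => phase p.1 := contDiff_phase.comp contDiff_fst
  have hc : ContDiff ℝ ∞ fun p : ℝ × ℂ => conj p.2 := Complex.conjCLE.contDiff.comp contDiff_snd
  refine ContDiff.prodMk ?_ ?_
  · exact contDiff_const.sub (contDiff_const.mul
      (Complex.imCLM.contDiff.comp ((hc.mul hp).mul contDiff_const)))
  · exact (hp.mul contDiff_const).mul (contDiff_const.sub (contDiff_snd.mul hc))

lemma fderiv_mulAux (x : SLTilde) (v : ℝ × ℂ) :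
    fderiv ℝ (mulAux (x : ℝ × ℂ)) 0 v = leftField v x := by
  obtain ⟨p, hp⟩ := x
  change ‖p.2‖ < 1 at hp
  have hd : DifferentiableAt ℝ (mulAux p) 0 := by
    have := (contDiffAt_mulAux (p, 0) hp (by simp)).differentiableAt (by simp)
    exact this.comp (0 : ℝ × ℂ) ((differentiableAt_const p).prodMk differentiableAt_id)
  have h1 : HasDerivAt (fun t : ℝ => mulAux p (t • v)) (fderiv ℝ (mulAux p) 0 v) 0 := by
    have hl : HasDerivAt (fun t : ℝ => t • v) v 0 := by
      simpa using (hasDerivAt_id (0 : ℝ)).smul_const v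
    have h0 : HasFDerivAt (mulAux p) (fderiv ℝ (mulAux p) 0) ((0 : ℝ) • v) := by
      rw [zero_smul]; exact hd.hasFDerivAt
    exact HasFDerivAt.comp_hasDerivAt (0 : ℝ) h0 hl
  have ht : HasDerivAt (fun t : ℝ => (t : ℂ) * v.2) v.2 0 := by
    simpa using (Complex.ofRealCLM.hasDerivAt (x := (0 : ℝ))).mul_const v.2
  have hden : HasDerivAt (fun t : ℝ => den p ((t : ℂ) * v.2)) (conj p.2 * phase p.1 * v.2) 0 := by
    simpa [den] using (ht.const_mul (conj p.2 * phase p.1)).const_add 1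
  have hden0 : den p (((0 : ℝ) : ℂ) * v.2) = 1 := by simp [den]
  have hlog := hden.clog_real (by rw [hden0]; simp)
  have harg : HasDerivAt (fun t : ℝ => (den p ((t : ℂ) * v.2)).arg)
      (conj p.2 * phase p.1 * v.2).im 0 := by
    have := Complex.imCLM.hasFDerivAt.comp_hasDerivAt (0 : ℝ) hlog
    rw [hden0] at this
    simpa [Function.comp_def, Complex.log_im] using this
  have hmob : HasDerivAt (fun t : ℝ => mobius p ((t : ℂ) * v.2))
      (phase p.1 * v.2 * (1 - p.2 * conj p.2)) 0 := by
    have := ((ht.const_mul (phase p.1)).add_const p.2).div hden (by rw [hden0]; simp)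
    rw [hden0] at this
    refine this.congr_deriv ?_
    simp only [Complex.ofReal_zero]
    ring
  have h2 : HasDerivAt (fun t : ℝ => mulAux p (t • v)) (leftField v p) 0 := by
    have ha : HasDerivAt (fun t : ℝ => p.1 + t * v.1 - 2 * (den p ((t : ℂ) * v.2)).arg)
        (v.1 - 2 * (conj p.2 * phase p.1 * v.2).im) 0 := by
      have h3 : HasDerivAt (fun t : ℝ => p.1 + t * v.1) v.1 0 := by
        simpa using ((hasDerivAt_id (0 : ℝ)).mul_const v.1).const_add p.1
      exact h3.sub (harg.const_mul 2)
    simpa [mulAux, leftField] using ha.prodMk hmob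
  exact h1.unique h2

lemma mulInvariantVectorField_eq (v : LieSL) (x : SLTilde) :
    mulInvariantVectorField v x = leftField v (x : ℝ × ℂ) := by
  have hm : MDifferentiableAt modelSL modelSL (fun y : SLTilde => x * y) 1 :=
    (contMDiff_mul_left (I := modelSL) (n := ∞)).mdifferentiable (by simp) 1
  have h1 : mfderiv modelSL modelSL (incl ∘ fun y : SLTilde => x * y) 1
      = mfderiv modelSL modelSL (fun y : SLTilde => x * y) 1 := by
    rw [mfderiv_comp (I' := modelSL) 1 (mdifferentiable_incl _) hm, mfderiv_incl]
    rfl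
  have h2 : MDifferentiableAt modelSL modelSL (incl ∘ fun y : SLTilde => x * y) 1 :=
    MDifferentiableAt.comp (I' := modelSL) 1 (mdifferentiable_incl _) hm
  have h3 : ((incl ∘ fun y : SLTilde => x * y) ∘ retract) =ᶠ[nhds ((1 : SLTilde) : ℝ × ℂ)]
      mulAux (x : ℝ × ℂ) := by
    filter_upwards [lineTimesDisc_mem_nhds 1] with p hp
    simp only [Function.comp, incl, coe_mul, coe_retract hp]
  have h4 := mfderiv_eq_fderiv_retract _ _ h2
  rw [h3.fderiv_eq] at h4
  have h5 := h1.symm.trans h4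
  have h6 := congrArg (fun T : (ℝ × ℂ) →L[ℝ] (ℝ × ℂ) => T v) h5
  exact h6.trans (fderiv_mulAux x v)

end Coordinates

/-! ### The Lie bracket -/

/-- The differential of the inclusion is the identity, so that the pull-back of a vector field is
its restriction. -/
lemma mpullback_incl (V : ℝ × ℂ → ℝ × ℂ) (x : SLTilde) :
    mpullback modelSL modelSL incl V x = V (x : ℝ × ℂ) := by
  have h : mfderiv modelSL modelSL incl x = ContinuousLinearMap.id ℝ (ℝ × ℂ) := mfderiv_incl x
  have h2 : (ContinuousLinearMap.id ℝ (ℝ × ℂ)).inverse (V x) = V x := by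
    rw [ContinuousLinearMap.inverse_id]; rfl
  refine Eq.trans ?_ h2
  exact congrArg (fun T : (ℝ × ℂ) →L[ℝ] (ℝ × ℂ) => T.inverse (V x)) h

lemma mdifferentiableAt_leftField (v p : ℝ × ℂ) :
    MDifferentiableAt modelSL modelSL.tangent
      (fun q : ℝ × ℂ => (⟨q, leftField v q⟩ : TangentBundle modelSL (ℝ × ℂ))) p := by
  have h := ((contDiff_leftField v).contDiffAt (x := p))
  exact (contMDiffAt_vectorSpace_iff_contDiffAt.2 h).mdifferentiableAt (by simp)

lemma mlieBracket_eq_lieBracket (V W : ℝ × ℂ → ℝ × ℂ) :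
    mlieBracket modelSL V W = lieBracket ℝ V W :=
  (mlieBracketWithin_univ (I := modelSL) (V := V) (W := W)).symm.trans
    (mlieBracketWithin_eq_lieBracketWithin.trans lieBracketWithin_univ)

lemma mlieBracket_mulInvariantVectorField (v w : LieSL) (x : SLTilde) :
    mlieBracket modelSL (mulInvariantVectorField v) (mulInvariantVectorField w) x
      = lieBracket ℝ (leftField v) (leftField w) (x : ℝ × ℂ) := by
  have h := mpullback_mlieBracket (I := modelSL) (I' := modelSL) (n := ∞) (f := incl) (x₀ := x)
    (mdifferentiableAt_leftField v _) (mdifferentiableAt_leftField w _)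
    contMDiff_incl.contMDiffAt (by
      rw [minSmoothness_of_isRCLikeNormedField]
      exact WithTop.coe_le_coe.2 (le_top : (2 : ℕ∞) ≤ ⊤))
  have e : ∀ u : LieSL, mpullback modelSL modelSL incl (leftField u)
      = (mulInvariantVectorField u : VField) := fun u => by
    funext y
    exact (mpullback_incl _ y).trans (mulInvariantVectorField_eq u y).symm
  have h2 := mpullback_incl (lieBracket ℝ (leftField v) (leftField w)) x
  rw [← e v, ← e w, ← h]
  have e3 := mlieBracket_eq_lieBracket (leftField v) (leftField w)
  exact (congrArg (fun V => mpullback modelSL modelSL incl V x) e3).trans h2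

/-- The Lie bracket on `𝔰𝔩(2,ℝ)` in the coordinates of `ℝ × ℂ`. -/
def brk (v w : ℝ × ℂ) : ℝ × ℂ :=
  (-(4 * (conj v.2 * w.2).im), Complex.I * (v.1 * w.2 - w.1 * v.2))

lemma fderiv_leftField_zero (v u : ℝ × ℂ) :
    fderiv ℝ (leftField v) 0 u = (-(2 * (conj u.2 * v.2).im), Complex.I * u.1 * v.2) := by
  have hd : DifferentiableAt ℝ (leftField v) 0 := (contDiff_leftField v).differentiable (by simp) 0
  have h1 : HasDerivAt (fun t : ℝ => leftField v (t • u)) (fderiv ℝ (leftField v) 0 u) 0 := by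
    have hl : HasDerivAt (fun t : ℝ => t • u) u 0 := by
      simpa using (hasDerivAt_id (0 : ℝ)).smul_const u
    have h0 : HasFDerivAt (leftField v) (fderiv ℝ (leftField v) 0) ((0 : ℝ) • u) := by
      rw [zero_smul]; exact hd.hasFDerivAt
    exact HasFDerivAt.comp_hasDerivAt (0 : ℝ) h0 hl
  have hp : HasDerivAt (fun t : ℝ => phase (t * u.1)) (Complex.I * u.1) 0 := by
    have h := (((Complex.ofRealCLM.hasDerivAt (x := (0 : ℝ))).mul_const (u.1 : ℂ)).mul_const
      Complex.I).cexp
    refine (h.congr_deriv ?_).congr_of_eventuallyEq (Filter.Eventually.of_forall fun t => ?_)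
    · simp [mul_comm]
    · simp [phase]
  have hc : HasDerivAt (fun t : ℝ => (t : ℂ) * conj u.2) (conj u.2) 0 := by
    simpa using (Complex.ofRealCLM.hasDerivAt (x := (0 : ℝ))).mul_const (conj u.2)
  have ht : HasDerivAt (fun t : ℝ => (t : ℂ) * u.2) u.2 0 := by
    simpa using (Complex.ofRealCLM.hasDerivAt (x := (0 : ℝ))).mul_const u.2
  have h2 : HasDerivAt (fun t : ℝ => leftField v (t • u))
      (-(2 * (conj u.2 * v.2).im), Complex.I * u.1 * v.2) 0 := by
    have ha := Complex.imCLM.hasFDerivAt.comp_hasDerivAt (0 : ℝ) ((hc.mul hp).mul_const v.2)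
    have ha' := (ha.const_mul 2).const_sub v.1
    have hb := (hp.mul_const v.2).mul ((ht.mul hc).const_sub 1)
    refine ((ha'.prodMk hb).congr_deriv ?_).congr_of_eventuallyEq
      (Filter.Eventually.of_forall fun t => ?_)
    · simp [phase]
    · simp [leftField]
  exact h1.unique h2

lemma lieBracket_leftField_zero (v w : ℝ × ℂ) :
    lieBracket ℝ (leftField v) (leftField w) 0 = brk v w := by
  have e : ∀ u, leftField u 0 = u := fun u => by simp [leftField, phase]
  rw [lieBracket_eq]
  simp only [e, fderiv_leftField_zero, brk]
  ext
  · simp; ring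
  · simp; ring

lemma bracket_eq (v w : LieSL) : ⁅v, w⁆ = brk v w := by
  rw [GroupLieAlgebra.bracket_def]
  exact (mlieBracket_mulInvariantVectorField v w 1).trans (lieBracket_leftField_zero v w)

instance : LieGroup modelSL (minSmoothness ℝ 3) SLTilde :=
  LieGroup.of_le (n := ∞) (by
    rw [minSmoothness_of_isRCLikeNormedField]
    exact WithTop.coe_le_coe.2 (le_top : (3 : ℕ∞) ≤ ⊤))

/-- The bracket of left invariant fields, deduced from its value at the identity by left
invariance. -/
lemma lieBracket_leftField (v w : ℝ × ℂ) (x : SLTilde) :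
    lieBracket ℝ (leftField v) (leftField w) (x : ℝ × ℂ) = leftField (brk v w) x := by
  let v' : LieSL := v
  let w' : LieSL := w
  have h := congrFun (mulInvariantVector_mlieBracket (I := modelSL) (G := SLTilde) v' w') x
  have h1 := mlieBracket_mulInvariantVectorField v' w' x
  have h2 := mulInvariantVectorField_eq ⁅v', w'⁆ x
  rw [bracket_eq] at h2
  rw [← GroupLieAlgebra.bracket_def, bracket_eq] at h
  exact h1.symm.trans (h.symm.trans h2)

/-! ### Derivatives along left invariant fields -/

section LeftDerivatives

variable {F : Type*} [NormedAddCommGroup F] [NormedSpace ℝ F]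

/-- The derivative of a function along the left invariant vector field with value `v` at the
identity, computed in the coordinates of `ℝ × ℂ`. -/
def lieD (v : ℝ × ℂ) (f : SLTilde → F) (x : SLTilde) : F :=
  fderiv ℝ (f ∘ retract) (x : ℝ × ℂ) (leftField v x)

lemma lieD_eq_mfderiv (v : LieSL) (f : SLTilde → F) (hf : ContMDiff modelSL 𝓘(ℝ, F) ∞ f)
    (x : SLTilde) :
    lieD v f x = (mfderiv modelSL 𝓘(ℝ, F) f x : TangentSpace modelSL x →L[ℝ] F)
      (mulInvariantVectorField v x) := by
  have h1 := mfderiv_eq_fderiv_retract f x (hf.mdifferentiable (by simp) x)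
  have h2 := mulInvariantVectorField_eq v x
  exact (congrArg (fun T : (ℝ × ℂ) →L[ℝ] F => T (leftField v x)) h1).symm.trans
    (congrArg (fun u => (mfderiv modelSL 𝓘(ℝ, F) f x : (ℝ × ℂ) →L[ℝ] F) u) h2).symm

lemma contDiffAt_retract_of_mem {f : SLTilde → F} (hf : ContMDiff modelSL 𝓘(ℝ, F) ∞ f)
    (x : SLTilde) : ContDiffAt ℝ ∞ (f ∘ retract) (x : ℝ × ℂ) :=
  contDiffAt_comp_retract le_rfl f x (hf x)

lemma contMDiff_of_retract {f : SLTilde → F} {G : ℝ × ℂ → F}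
    (h : ∀ x : SLTilde, f x = G x) (hG : ∀ x : SLTilde, ContDiffAt ℝ ∞ G (x : ℝ × ℂ)) :
    ContMDiff modelSL 𝓘(ℝ, F) ∞ f := by
  have : f = G ∘ incl := funext h
  rw [this]
  intro x
  exact ContMDiffAt.comp (I' := modelSL) x (hG x).contMDiffAt (contMDiff_incl x)

lemma contDiffAt_fderiv_retract {f : SLTilde → F} (hf : ContMDiff modelSL 𝓘(ℝ, F) ∞ f)
    (x : SLTilde) : ContDiffAt ℝ ∞ (fderiv ℝ (f ∘ retract)) (x : ℝ × ℂ) :=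
  (contDiffAt_retract_of_mem hf x).fderiv_right (m := ∞) (by simp)

lemma contMDiff_lieD (v : ℝ × ℂ) {f : SLTilde → F} (hf : ContMDiff modelSL 𝓘(ℝ, F) ∞ f) :
    ContMDiff modelSL 𝓘(ℝ, F) ∞ (lieD v f) :=
  contMDiff_of_retract (G := fun p => fderiv ℝ (f ∘ retract) p (leftField v p)) (fun _ => rfl)
    fun x => (contDiffAt_fderiv_retract hf x).clm_apply (contDiff_leftField v).contDiffAt

lemma leftField_add (v w p : ℝ × ℂ) : leftField (v + w) p = leftField v p + leftField w p := by
  ext <;> simp [leftField] <;> ring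

lemma leftField_smul (c : ℝ) (v p : ℝ × ℂ) : leftField (c • v) p = c • leftField v p := by
  ext <;> simp [leftField] <;> ring

lemma lieD_add (v w : ℝ × ℂ) (f : SLTilde → F) (x : SLTilde) :
    lieD (v + w) f x = lieD v f x + lieD w f x := by
  simp [lieD, leftField_add]

lemma lieD_smul (c : ℝ) (v : ℝ × ℂ) (f : SLTilde → F) (x : SLTilde) :
    lieD (c • v) f x = c • lieD v f x := by
  simp [lieD, leftField_smul]

lemma lieD_lieD (v w : ℝ × ℂ) {f : SLTilde → F} (hf : ContMDiff modelSL 𝓘(ℝ, F) ∞ f)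
    (x : SLTilde) :
    lieD v (lieD w f) x = fderiv ℝ (fderiv ℝ (f ∘ retract)) (x : ℝ × ℂ) (leftField v x)
      (leftField w x) + fderiv ℝ (f ∘ retract) (x : ℝ × ℂ)
        (fderiv ℝ (leftField w) x (leftField v x)) := by
  have h1 : (lieD w f ∘ retract) =ᶠ[nhds (x : ℝ × ℂ)]
      fun p => fderiv ℝ (f ∘ retract) p (leftField w p) := by
    filter_upwards [lineTimesDisc_mem_nhds x] with p hp
    simp [lieD, coe_retract hp]
  rw [lieD, h1.fderiv_eq, fderiv_clm_apply
    ((contDiffAt_fderiv_retract hf x).differentiableAt (by simp))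
    ((contDiff_leftField w).differentiable (by simp) _)]
  simp [add_comm]

/-- The commutator of two left invariant derivations. -/
lemma lieD_comm (v w : ℝ × ℂ) {f : SLTilde → F} (hf : ContMDiff modelSL 𝓘(ℝ, F) ∞ f)
    (x : SLTilde) :
    lieD v (lieD w f) x - lieD w (lieD v f) x = lieD (brk v w) f x := by
  have hs : IsSymmSndFDerivAt ℝ (f ∘ retract) (x : ℝ × ℂ) :=
    (contDiffAt_retract_of_mem hf x).isSymmSndFDerivAt (by
      rw [minSmoothness_of_isRCLikeNormedField]
      exact WithTop.coe_le_coe.2 (le_top : (2 : ℕ∞) ≤ ⊤))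
  rw [lieD_lieD v w hf, lieD_lieD w v hf, hs (leftField v x) (leftField w x), lieD,
    ← lieBracket_leftField, lieBracket_eq]
  simp

/-- The left invariant Maurer–Cartan form: the inverse of `v ↦ leftField v p`. -/
def coframe (p u : ℝ × ℂ) : ℝ × ℂ :=
  (u.1 + 2 * (conj p.2 * (u.2 / (1 - p.2 * conj p.2))).im,
    conj (phase p.1) * u.2 / (1 - p.2 * conj p.2))

lemma one_sub_mul_conj_ne_zero (x : SLTilde) :
    1 - (x : ℝ × ℂ).2 * conj (x : ℝ × ℂ).2 ≠ 0 := by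
  have hz : ‖(x : ℝ × ℂ).2‖ < 1 := x.2
  have hpos : (0 : ℝ) < 1 - Complex.normSq (x : ℝ × ℂ).2 := by
    rw [Complex.normSq_eq_norm_sq]; nlinarith [norm_nonneg (x : ℝ × ℂ).2]
  rw [Complex.mul_conj]
  exact_mod_cast hpos.ne'

lemma leftField_coframe (x : SLTilde) (u : ℝ × ℂ) : leftField (coframe x u) x = u := by
  have h := one_sub_mul_conj_ne_zero x
  have h2 := phase_mul_conj (x : ℝ × ℂ).1
  have e : phase (x : ℝ × ℂ).1 * (conj (phase (x : ℝ × ℂ).1) * u.2 /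
      (1 - (x : ℝ × ℂ).2 * conj (x : ℝ × ℂ).2)) = u.2 /
      (1 - (x : ℝ × ℂ).2 * conj (x : ℝ × ℂ).2) := by
    rw [mul_div_assoc', ← mul_assoc, h2, one_mul]
  refine Prod.ext ?_ ?_
  · simp only [leftField, coframe]
    rw [mul_assoc, e]; ring
  · simp only [leftField, coframe]
    rw [e, div_mul_cancel₀ _ h]

lemma coframe_leftField (x : SLTilde) (v : ℝ × ℂ) : coframe x (leftField v x) = v := by
  have h := one_sub_mul_conj_ne_zero x
  have h2 := phase_mul_conj (x : ℝ × ℂ).1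
  have e : phase (x : ℝ × ℂ).1 * v.2 * (1 - (x : ℝ × ℂ).2 * conj (x : ℝ × ℂ).2) /
      (1 - (x : ℝ × ℂ).2 * conj (x : ℝ × ℂ).2) = phase (x : ℝ × ℂ).1 * v.2 :=
    mul_div_cancel_right₀ _ h
  refine Prod.ext ?_ ?_
  · simp only [leftField, coframe]
    rw [e, ← mul_assoc]; ring
  · simp only [leftField, coframe]
    rw [mul_div_assoc, e, ← mul_assoc, mul_comm (conj _), h2, one_mul]

lemma contMDiff_coframe {f g : SLTilde → ℝ × ℂ} (hf : ContMDiff modelSL modelSL ∞ f)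
    (hg : ContMDiff modelSL modelSL ∞ g) (h : ∀ x, ∃ y : SLTilde, f x = y) :
    ContMDiff modelSL modelSL ∞ (fun x => coframe (f x) (g x)) := by
  refine contMDiff_of_retract
    (G := fun p => coframe ((f ∘ retract) p) ((g ∘ retract) p))
    (fun x => by simp [retract_coe]) fun x => ?_
  have h1 := contDiffAt_retract_of_mem hf x
  have h2 := contDiffAt_retract_of_mem hg x
  have hc : ContDiffAt ℝ ∞ (fun p => conj ((f ∘ retract) p).2) (x : ℝ × ℂ) :=
    Complex.conjCLE.contDiff.contDiffAt.comp (x : ℝ × ℂ) (contDiff_snd.contDiffAt.comp _ h1)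
  have hp : ContDiffAt ℝ ∞ (fun p => phase ((f ∘ retract) p).1) (x : ℝ × ℂ) :=
    contDiff_phase.contDiffAt.comp (x : ℝ × ℂ) (contDiff_fst.contDiffAt.comp _ h1)
  have hpc : ContDiffAt ℝ ∞ (fun p => conj (phase ((f ∘ retract) p).1)) (x : ℝ × ℂ) :=
    Complex.conjCLE.contDiff.contDiffAt.comp (x : ℝ × ℂ) hp
  have h12 : ContDiffAt ℝ ∞ (fun p => ((f ∘ retract) p).2) (x : ℝ × ℂ) :=
    contDiff_snd.contDiffAt.comp _ h1
  have h22 : ContDiffAt ℝ ∞ (fun p => ((g ∘ retract) p).2) (x : ℝ × ℂ) :=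
    contDiff_snd.contDiffAt.comp _ h2
  have h21 : ContDiffAt ℝ ∞ (fun p => ((g ∘ retract) p).1) (x : ℝ × ℂ) :=
    contDiff_fst.contDiffAt.comp _ h2
  have hden : ContDiffAt ℝ ∞ (fun p => 1 - ((f ∘ retract) p).2 * conj ((f ∘ retract) p).2)
      (x : ℝ × ℂ) := contDiffAt_const.sub (h12.mul hc)
  have hne : 1 - ((f ∘ retract) x).2 * conj ((f ∘ retract) x).2 ≠ 0 := by
    obtain ⟨y, hy⟩ := h (retract x)
    simp only [Function.comp, hy]
    exact one_sub_mul_conj_ne_zero y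
  have him : ContDiffAt ℝ ∞ (fun p => (conj ((f ∘ retract) p).2 * (((g ∘ retract) p).2 /
      (1 - ((f ∘ retract) p).2 * conj ((f ∘ retract) p).2))).im) (x : ℝ × ℂ) :=
    Complex.imCLM.contDiff.contDiffAt.comp (x : ℝ × ℂ) (hc.mul (h22.mul (hden.inv hne)))
  exact (h21.add (contDiffAt_const.mul him)).prodMk ((hpc.mul h22).mul (hden.inv hne))

/-- The differential of `φ` at `x` in the left invariant trivialisations of the tangent spaces at
`x` and `φ x`. -/
def frameMap (φ : SLTilde → SLTilde) (v : ℝ × ℂ) (x : SLTilde) : ℝ × ℂ :=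
  coframe (φ x) (lieD v (incl ∘ φ) x)

lemma leftField_frameMap (φ : SLTilde → SLTilde) (v : ℝ × ℂ) (x : SLTilde) :
    leftField (frameMap φ v x) (φ x) = lieD v (incl ∘ φ) x := leftField_coframe _ _

lemma contMDiff_frameMap {φ : SLTilde → SLTilde} (hφ : ContMDiff modelSL modelSL ∞ φ)
    (v : ℝ × ℂ) : ContMDiff modelSL modelSL ∞ (frameMap φ v) :=
  contMDiff_coframe (contMDiff_incl.comp hφ) (contMDiff_lieD v (contMDiff_incl.comp hφ))
    fun x => ⟨φ x, rfl⟩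

lemma lieD_comp {φ : SLTilde → SLTilde} (hφ : ContMDiff modelSL modelSL ∞ φ) {f : SLTilde → F}
    (hf : ContMDiff modelSL 𝓘(ℝ, F) ∞ f) (v : ℝ × ℂ) (x : SLTilde) :
    lieD v (f ∘ φ) x = lieD (frameMap φ v x) f (φ x) := by
  have h1 : (f ∘ φ) ∘ retract = (f ∘ retract) ∘ ((incl ∘ φ) ∘ retract) := by
    funext p; simp [incl, retract_coe]
  have h2 := (contDiffAt_retract_of_mem (contMDiff_incl.comp hφ) x).differentiableAt (by simp)
  have h3 : ((incl ∘ φ) ∘ retract) (x : ℝ × ℂ) = (φ x : ℝ × ℂ) := by simp [incl, retract_coe]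
  have h4 : DifferentiableAt ℝ (f ∘ retract) (((incl ∘ φ) ∘ retract) (x : ℝ × ℂ)) := by
    rw [h3]; exact (contDiffAt_retract_of_mem hf (φ x)).differentiableAt (by simp)
  rw [lieD, h1, fderiv_comp _ h4 h2, h3, lieD, leftField_frameMap, lieD]
  rfl

/-- The intrinsic meaning of `frameMap`. -/
lemma mfderiv_mulInvariantVectorField {φ : SLTilde → SLTilde}
    (hφ : ContMDiff modelSL modelSL ∞ φ) (v : LieSL) (x : SLTilde) :
    mfderiv modelSL modelSL φ x (mulInvariantVectorField v x)
      = mulInvariantVectorField (G := SLTilde) (frameMap φ v x : LieSL) (φ x) := by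
  have h1 := lieD_eq_mfderiv v (incl ∘ φ) (contMDiff_incl.comp hφ) x
  have h2 : mfderiv modelSL modelSL (incl ∘ φ) x = mfderiv modelSL modelSL φ x := by
    rw [mfderiv_comp (I' := modelSL) x (mdifferentiable_incl _) (hφ.mdifferentiable (by simp) x),
      mfderiv_incl]
    rfl
  have h3 := mulInvariantVectorField_eq (frameMap φ v x : LieSL) (φ x)
  have h4 := congrArg (fun T : (ℝ × ℂ) →L[ℝ] (ℝ × ℂ) => T (mulInvariantVectorField v x)) h2
  exact h4.symm.trans (h1.symm.trans ((leftField_frameMap φ v x).symm.trans h3.symm))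

end LeftDerivatives

open Matrix

/-! ### Orthogonal changes of frame -/

/-- The matrix of `v ↦ u × v`. -/
def crossMatrix {R : Type*} [CommRing R] (u : Fin 3 → R) : Matrix (Fin 3) (Fin 3) R :=
  !![0, -u 2, u 1; u 2, 0, -u 0; -u 1, u 0, 0]

section Algebra

lemma crossMatrix_transpose {R : Type*} [CommRing R] (u : Fin 3 → R) :
    (crossMatrix u)ᵀ = -crossMatrix u := by
  ext i j
  fin_cases i <;> fin_cases j <;> simp [crossMatrix]

variable {R : Type*} [CommRing R] [Algebra ℝ R]

lemma eq_of_two_mul_eq {a b : R} (h : 2 * a = 2 * b) : a = b := by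
  have h2 : (algebraMap ℝ R (1 / 2)) * 2 = 1 := by
    rw [← map_ofNat (algebraMap ℝ R) 2, ← map_mul]; norm_num
  calc a = (algebraMap ℝ R (1 / 2)) * 2 * a := by rw [h2, one_mul]
    _ = (algebraMap ℝ R (1 / 2)) * 2 * b := by rw [mul_assoc, h, mul_assoc]
    _ = b := by rw [h2, one_mul]

section Derivation

variable (d : Derivation ℝ R R)

lemma map_derivation_mul (A B : Matrix (Fin 3) (Fin 3) R) :
    (A * B).map d = A.map d * B + A * B.map d := by
  ext i j
  simp only [map_apply, mul_apply, map_sum, Derivation.leibniz, Matrix.add_apply, smul_eq_mul,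
    ← Finset.sum_add_distrib]
  exact Finset.sum_congr rfl fun k _ => by ring

lemma map_derivation_const (A : Matrix (Fin 3) (Fin 3) ℝ) :
    (A.map (algebraMap ℝ R)).map d = 0 := by
  ext i j
  simp

lemma map_derivation_crossMatrix (u : Fin 3 → R) :
    (crossMatrix u).map d = crossMatrix (fun i => d (u i)) := by
  ext i j
  fin_cases i <;> fin_cases j <;> simp [crossMatrix]

lemma map_derivation_conj {A : Matrix (Fin 3) (Fin 3) R} {u : Fin 3 → R}
    (h : A.map d = crossMatrix u * A) (M : Matrix (Fin 3) (Fin 3) ℝ) :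
    (A * M.map (algebraMap ℝ R) * Aᵀ).map d
      = crossMatrix u * (A * M.map (algebraMap ℝ R) * Aᵀ)
        - A * M.map (algebraMap ℝ R) * Aᵀ * crossMatrix u := by
  have ht : Aᵀ.map d = -(Aᵀ * crossMatrix u) := by
    rw [transpose_map, h, transpose_mul, crossMatrix_transpose, mul_neg]
  rw [map_derivation_mul, map_derivation_mul, map_derivation_const, h, ht]
  simp only [mul_zero, add_zero, mul_neg, Matrix.mul_assoc, sub_eq_add_neg]

end Derivation

/-- The structure equation of an orthogonal change of frame determines its derivative. In terms of
`S = ε A M Aᵀ`, `M = diagonal μ`, it reads `(δ_i A) Aᵀ = (Y e_i) ×` with `Y = S - M`, the difference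
of two Levi-Civita connections. -/
lemma map_derivation_eq_crossMatrix_mul (δ : Fin 3 → Derivation ℝ R R) (μ : Fin 3 → ℝ) (ε : ℝ)
    (A : Matrix (Fin 3) (Fin 3) R) (hA : A * Aᵀ = 1)
    (hstr : ∀ i m, δ i (A (i + 1) m) - δ (i + 1) (A i m)
      = algebraMap ℝ R ((μ i + μ (i + 1)) - ε * (μ (m + 1) + μ (m + 2))) * A (i + 2) m)
    (S : Matrix (Fin 3) (Fin 3) R)
    (hS : S = ε • (A * (diagonal μ).map (algebraMap ℝ R) * Aᵀ)) (i : Fin 3) :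
    A.map (δ i) = crossMatrix (fun r => S r i - (diagonal μ).map (algebraMap ℝ R) r i) * A := by
  have hA' : Aᵀ * A = 1 := mul_eq_one_comm.1 hA
  -- As in the Koszul formula, `W i j q` is skew in `j, q` because `A` is orthogonal, the structure
  -- equation gives its skew part in `i, j`, and the two determine it.
  set W : Fin 3 → Matrix (Fin 3) (Fin 3) R := fun i => A.map (δ i) * Aᵀ with hW
  have hskew : ∀ i j q, W i j q = -W i q j := by
    intro i j q
    have h1 : (A * Aᵀ).map (δ i) = 0 := by
      rw [hA]; ext a b; simp [one_apply, apply_ite (δ i)]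
    rw [map_derivation_mul] at h1
    have h2 : A * Aᵀ.map (δ i) = (W i)ᵀ := by
      rw [hW, transpose_mul, transpose_transpose, transpose_map]
    rw [h2] at h1
    have := congrFun (congrFun h1 j) q
    simp only [Matrix.add_apply, transpose_apply, Matrix.zero_apply] at this
    exact eq_neg_of_add_eq_zero_left this
  have hAA : ∀ j q, ∑ m, A j m * A q m = if j = q then 1 else 0 := fun j q => by
    have := congrFun (congrFun hA j) q
    simpa [mul_apply, one_apply] using this
  have hSe : ∀ j q, S j q = algebraMap ℝ R ε * ∑ m, algebraMap ℝ R (μ m) * (A j m * A q m) := by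
    intro j q
    rw [hS, Matrix.smul_apply, Algebra.smul_def]
    congr 1
    simp only [mul_apply, map_apply, diagonal_apply, transpose_apply, Fin.sum_univ_three]
    simp
    ring
  -- the trace of `S` is constant
  have htr : S 0 0 + S 1 1 + S 2 2 = algebraMap ℝ R (ε * (μ 0 + μ 1 + μ 2)) := by
    have h3 : ∀ m, A 0 m * A 0 m + A 1 m * A 1 m + A 2 m * A 2 m = 1 := fun m => by
      have := congrFun (congrFun hA' m) m
      simpa [mul_apply, one_apply, Fin.sum_univ_three] using this
    simp only [hSe, Fin.sum_univ_three, map_mul, map_add]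
    linear_combination (algebraMap ℝ R ε * algebraMap ℝ R (μ 0)) * h3 0
      + (algebraMap ℝ R ε * algebraMap ℝ R (μ 1)) * h3 1
      + (algebraMap ℝ R ε * algebraMap ℝ R (μ 2)) * h3 2
  have hW2 : ∀ i q, W i (i + 1) q - W (i + 1) i q
      = algebraMap ℝ R (μ i + μ (i + 1)) * (if i + 2 = q then 1 else 0)
        - (S 0 0 + S 1 1 + S 2 2) * (if i + 2 = q then 1 else 0) + S (i + 2) q := by
    intro i q
    rw [htr, ← hAA, hSe]
    have e : W i (i + 1) q - W (i + 1) i q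
        = ∑ m, (δ i (A (i + 1) m) - δ (i + 1) (A i m)) * A q m := by
      simp only [hW, mul_apply, map_apply, transpose_apply, sub_mul, Finset.sum_sub_distrib]
    rw [e]
    simp only [hstr, Fin.sum_univ_three]
    have f1 : (1 : Fin 3) + 1 = 2 := rfl
    have f2 : (1 : Fin 3) + 2 = 0 := rfl
    have f3 : (2 : Fin 3) + 1 = 0 := rfl
    have f4 : (2 : Fin 3) + 2 = 1 := rfl
    simp only [map_sub, map_add, map_mul, f1, f2, f3, f4, zero_add]
    ring
  have hWc : W i = crossMatrix (fun r => S r i - (diagonal μ).map (algebraMap ℝ R) r i) := by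
    have hsym : ∀ j q, S j q = S q j := fun j q => by
      rw [hSe, hSe]; simp only [mul_comm]
    have hd : ∀ i j, W i j j = 0 := fun i j => by
      apply eq_of_two_mul_eq
      have := hskew i j j
      linear_combination this
    have e00 := hW2 0 0
    have e01 := hW2 0 1
    have e02 := hW2 0 2
    have e10 := hW2 1 0
    have e11 := hW2 1 1
    have e12 := hW2 1 2
    have e20 := hW2 2 0
    have e21 := hW2 2 1
    have e22 := hW2 2 2
    have f1 : (1 : Fin 3) + 1 = 2 := rfl
    have f2 : (1 : Fin 3) + 2 = 0 := rfl
    have f3 : (2 : Fin 3) + 1 = 0 := rfl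
    have f4 : (2 : Fin 3) + 2 = 1 := rfl
    simp [f1, f2, f3, f4, hd] at e00 e01 e02 e10 e11 e12 e20 e21 e22
    have q0 := hskew 0 2 1
    have q1 := hskew 1 2 0
    have q2 := hskew 2 1 0
    have p0 := hskew 0 1 0
    have p1 := hskew 0 2 0
    have p2 := hskew 1 1 0
    have p3 := hskew 1 2 1
    have p4 := hskew 2 2 0
    have p5 := hskew 2 2 1
    have r01 := hsym 0 1
    have r02 := hsym 0 2
    have r12 := hsym 1 2
    ext a b
    fin_cases i <;> fin_cases a <;> fin_cases b <;> simp [crossMatrix, hd] <;>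
      first | grind | (apply eq_of_two_mul_eq; grind)
  calc A.map (δ i) = W i * A := by rw [hW]; simp only [Matrix.mul_assoc, hA', mul_one]
    _ = _ := by rw [hWc]

end Algebra

section Algebra

variable {R : Type*} [CommRing R] [Algebra ℝ R]

/-- The integrability condition of the equations `δ_i A = (Y e_i) × A`, `Y = S - M`, which comes
from the commutators of the `δ_i`. The matrix `2 adj M` is the Ricci tensor of the left invariant
metric, so that the conclusion is the invariance of the curvature. -/
lemma adjugate_eq_of_derivation_comm (δ : Fin 3 → Derivation ℝ R R) (μ : Fin 3 → ℝ) (ε : ℝ)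
    (hcomm : ∀ i f, δ i (δ (i + 1) f) - δ (i + 1) (δ i f)
      = algebraMap ℝ R (μ i + μ (i + 1)) * δ (i + 2) f)
    (A : Matrix (Fin 3) (Fin 3) R) (hA : A * Aᵀ = 1) (S : Matrix (Fin 3) (Fin 3) R)
    (hS : S = ε • (A * (diagonal μ).map (algebraMap ℝ R) * Aᵀ))
    (hd : ∀ i, A.map (δ i)
      = crossMatrix (fun r => S r i - (diagonal μ).map (algebraMap ℝ R) r i) * A) :
    S.adjugate = ((diagonal μ).adjugate).map (algebraMap ℝ R) := by
  set M : Matrix (Fin 3) (Fin 3) R := (diagonal μ).map (algebraMap ℝ R) with hM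
  set c : Fin 3 → Matrix (Fin 3) (Fin 3) R := fun i => crossMatrix (fun r => S r i - M r i) with hc
  have hdS : ∀ i, S.map (δ i) = c i * S - S * c i := by
    intro i
    have h := map_derivation_conj (δ i) (hd i) (diagonal μ)
    have e : S.map (δ i) = ε • (A * M * Aᵀ).map (δ i) := by
      rw [hS]; ext a b; simp
    have e2 : S.map (δ i) = ε • (c i * (A * M * Aᵀ) - A * M * Aᵀ * c i) := by rw [e, h]
    have e3 : c i * S = ε • (c i * (A * M * Aᵀ)) := by rw [← mul_smul_comm, ← hS]
    have e4 : S * c i = ε • (A * M * Aᵀ * c i) := by rw [← smul_mul_assoc, ← hS]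
    rw [e2, smul_sub, e3, e4]
  have hdc : ∀ i j, (c j).map (δ i) = crossMatrix (fun r => (c i * S - S * c i) r j) := by
    intro i j
    rw [hc, map_derivation_crossMatrix, ← hc]
    congr 1
    funext r
    have e : M r j = algebraMap ℝ R (diagonal μ r j) := rfl
    rw [← hdS, map_sub, e, Derivation.map_algebraMap, sub_zero]
    rfl
  -- both sides of `[δ_i, δ_{i+1}] A = (μ_i + μ_{i+1}) δ_{i+2} A`, multiplied by `Aᵀ` from the right
  have hT : ∀ i, crossMatrix (fun r => (c i * S - S * c i) r (i + 1)) + c (i + 1) * c i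
      - (crossMatrix (fun r => (c (i + 1) * S - S * c (i + 1)) r i) + c i * c (i + 1))
      = algebraMap ℝ R (μ i + μ (i + 1)) • c (i + 2) := by
    intro i
    have h2 : ∀ i j, (A.map (δ j)).map (δ i)
        = (crossMatrix (fun r => (c i * S - S * c i) r j) + c j * c i) * A := by
      intro i j
      rw [hd j, map_derivation_mul, hdc, hd i, add_mul, Matrix.mul_assoc]
    have h3 : (A.map (δ (i + 1))).map (δ i) - (A.map (δ i)).map (δ (i + 1))
        = algebraMap ℝ R (μ i + μ (i + 1)) • A.map (δ (i + 2)) := by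
      ext a b
      exact hcomm i (A a b)
    rw [h2, h2, hd (i + 2), ← sub_mul, ← smul_mul_assoc] at h3
    have h4 := congrArg (· * Aᵀ) h3
    simpa only [Matrix.mul_assoc, hA, mul_one] using h4
  have hsym : ∀ j q, S j q = S q j := fun j q => by
    have : Sᵀ = S := by
      rw [hS, hM]
      simp [transpose_mul, Matrix.mul_assoc, diagonal_map]
    exact congrFun (congrFun this q) j
  have f1 : (1 : Fin 3) + 1 = 2 := rfl
  have f2 : (1 : Fin 3) + 2 = 0 := rfl
  have f3 : (2 : Fin 3) + 1 = 0 := rfl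
  have f4 : (2 : Fin 3) + 2 = 1 := rfl
  -- For each `i` the equation is between skew matrices, which are determined by three entries; the
  -- entries of the adjugates are linear combinations of the nine resulting equations.
  have g := fun i a b => congrFun (congrFun (hT i) a) b
  simp only [hc, hM, crossMatrix] at g
  have g1 := g 0 2 1
  have g2 := g 0 0 2
  have g3 := g 0 1 0
  have g4 := g 1 2 1
  have g5 := g 1 0 2
  have g6 := g 1 1 0
  have g7 := g 2 2 1
  have g8 := g 2 0 2
  have g9 := g 2 1 0
  have s1 := hsym 1 0
  have s2 := hsym 2 0
  have s3 := hsym 2 1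
  simp [f1, f2, f3, f4, Matrix.mul_apply, vecMul, dotProduct, Fin.sum_univ_three, s1, s2, s3]
    at g1 g2 g3 g4 g5 g6 g7 g8 g9
  clear g hT hdc hdS hd hS hcomm
  rw [adjugate_fin_three, adjugate_fin_three]
  ext a b
  apply eq_of_two_mul_eq
  fin_cases a <;> fin_cases b <;> simp [s1, s2, s3]
  all_goals clear hsym hc hM s1 s2 s3 f1 f2 f3 f4 hA
  all_goals grind

end Algebra

lemma adjugate_diagonal_fin_three (μ : Fin 3 → ℝ) :
    (diagonal μ).adjugate = diagonal fun i => μ (i + 1) * μ (i + 2) := by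
  rw [adjugate_fin_three]
  ext i j
  fin_cases i <;> fin_cases j <;> simp [mul_comm]

section Algebra

lemma crossMatrix_zero {R : Type*} [CommRing R] : crossMatrix (fun _ => (0 : R)) = 0 := by
  ext i j
  fin_cases i <;> fin_cases j <;> simp [crossMatrix]

lemma adjugate_eq_smul_transpose {R : Type*} [CommRing R] {A : Matrix (Fin 3) (Fin 3) R}
    (hA : A * Aᵀ = 1) : A.adjugate = A.det • Aᵀ := by
  rw [← mul_one A.adjugate, ← hA, ← Matrix.mul_assoc, adjugate_mul, smul_mul_assoc, one_mul]

lemma adjugate_cyclic {R : Type*} [CommRing R] (A : Matrix (Fin 3) (Fin 3) R) (i m : Fin 3) :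
    A i (m + 1) * A (i + 1) (m + 2) - A i (m + 2) * A (i + 1) (m + 1) = A.adjugate m (i + 2) := by
  have f1 : (1 : Fin 3) + 1 = 2 := rfl
  have f2 : (1 : Fin 3) + 2 = 0 := rfl
  have f3 : (2 : Fin 3) + 1 = 0 := rfl
  have f4 : (2 : Fin 3) + 2 = 1 := rfl
  rw [adjugate_fin_three]
  fin_cases i <;> fin_cases m <;> simp [f1, f2, f3, f4] <;> ring

variable {R : Type*} [CommRing R] [Algebra ℝ R]

lemma eq_of_algebraMap_mul_eq {c : ℝ} (hc : c ≠ 0) {a b : R}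
    (h : algebraMap ℝ R c * a = algebraMap ℝ R c * b) : a = b := by
  have h2 : algebraMap ℝ R c⁻¹ * algebraMap ℝ R c = 1 := by
    rw [← map_mul, inv_mul_cancel₀ hc, map_one]
  calc a = algebraMap ℝ R c⁻¹ * (algebraMap ℝ R c * a) := by rw [← mul_assoc, h2, one_mul]
    _ = algebraMap ℝ R c⁻¹ * (algebraMap ℝ R c * b) := by rw [h]
    _ = b := by rw [← mul_assoc, h2, one_mul]

/-- Differentiating the invariance `A (adj M) Aᵀ = adj M` of the curvature shows that `Y e_i ×`
commutes with the diagonal matrix `adj M`, whose entries are the products `μ_{j+1} μ_{j+2}`. -/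
lemma curvature_diff_mul_eq_zero (δ : Fin 3 → Derivation ℝ R R) (μ : Fin 3 → ℝ) (ε : ℝ)
    (hε : ε ^ 2 = 1) (A : Matrix (Fin 3) (Fin 3) R) (hA : A * Aᵀ = 1)
    (hdet : A.det = algebraMap ℝ R ε) (S : Matrix (Fin 3) (Fin 3) R)
    (hS : S = ε • (A * (diagonal μ).map (algebraMap ℝ R) * Aᵀ))
    (hadj : S.adjugate = ((diagonal μ).adjugate).map (algebraMap ℝ R))
    (hd : ∀ i, A.map (δ i)
      = crossMatrix (fun r => S r i - (diagonal μ).map (algebraMap ℝ R) r i) * A) (i j : Fin 3) :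
    algebraMap ℝ R (μ (j + 2) * μ j - μ j * μ (j + 1))
      * (S j i - (diagonal μ).map (algebraMap ℝ R) j i) = 0 := by
  set C := (diagonal μ).adjugate with hC
  have hadjA := adjugate_eq_smul_transpose hA
  have hadjAt : Aᵀ.adjugate = algebraMap ℝ R ε • A := by
    rw [← adjugate_transpose, hadjA, hdet, transpose_smul, transpose_transpose]
  have hMadj : ((diagonal μ).map (algebraMap ℝ R)).adjugate = C.map (algebraMap ℝ R) :=
    ((algebraMap ℝ R).map_adjugate (diagonal μ)).symm
  have e2 : algebraMap ℝ R ε * algebraMap ℝ R ε = 1 := by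
    rw [← map_mul, ← sq, hε, map_one]
  have h1 : A * C.map (algebraMap ℝ R) * Aᵀ = C.map (algebraMap ℝ R) := by
    refine Eq.trans ?_ hadj
    rw [hS, ← algebraMap_smul R ε, adjugate_smul, adjugate_mul_distrib,
      adjugate_mul_distrib, hadjA, hadjAt, hMadj, hdet]
    simp only [Fintype.card_fin, Nat.add_one_sub_one, mul_smul_comm, smul_mul_assoc, smul_smul,
      Matrix.mul_assoc]
    rw [show algebraMap ℝ R ε ^ 2 * (algebraMap ℝ R ε * algebraMap ℝ R ε) = 1 by
      rw [sq, e2, one_mul], one_smul]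
  set u : Fin 3 → R := fun r => S r i - (diagonal μ).map (algebraMap ℝ R) r i with hu
  have h2 : (A * C.map (algebraMap ℝ R) * Aᵀ).map (δ i)
    = crossMatrix u * (A * C.map (algebraMap ℝ R) * Aᵀ)
      - A * C.map (algebraMap ℝ R) * Aᵀ * crossMatrix u := map_derivation_conj (δ i) (hd i) C
  change algebraMap ℝ R (μ (j + 2) * μ j - μ j * μ (j + 1)) * u j = 0
  clear_value u
  rw [h1, map_derivation_const, hC, adjugate_diagonal_fin_three] at h2
  have f1 : (1 : Fin 3) + 1 = 2 := rfl
  have f2 : (1 : Fin 3) + 2 = 0 := rfl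
  have f3 : (2 : Fin 3) + 1 = 0 := rfl
  have f4 : (2 : Fin 3) + 2 = 1 := rfl
  rw [diagonal_map (by simp)] at h2
  have h3 := fun a b => congrFun (congrFun h2 a) b
  simp only [Matrix.sub_apply, mul_diagonal, diagonal_mul, Matrix.zero_apply] at h3
  have k0 := h3 2 1
  have k1 := h3 0 2
  have k2 := h3 1 0
  simp only [crossMatrix, f1, f2, f3, f4, zero_add] at k0 k1 k2
  simp at k0 k1 k2
  fin_cases j <;> simp [f1, f2, f3, f4]
  · linear_combination -k0
  · linear_combination -k1
  · linear_combination -k2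

/-- An orthogonal change of frame which satisfies the structure equation is constant. The sign
conditions on the `μ_i` hold for the left invariant metrics on `S̃l(2,ℝ)`; they exclude the case of
constant curvature, where the conclusion can fail. -/
theorem map_derivation_eq_zero_of_structure_equation (δ : Fin 3 → Derivation ℝ R R)
    (μ : Fin 3 → ℝ) (hμ0 : 0 < μ 0) (hμ12 : μ 1 + μ 2 < 0)
    (ε : ℝ) (hε : ε ^ 2 = 1)
    (hcomm : ∀ i f, δ i (δ (i + 1) f) - δ (i + 1) (δ i f)
      = algebraMap ℝ R (μ i + μ (i + 1)) * δ (i + 2) f)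
    (A : Matrix (Fin 3) (Fin 3) R) (hA : A * Aᵀ = 1) (hdet : A.det = algebraMap ℝ R ε)
    (hstr : ∀ i m, δ i (A (i + 1) m) - δ (i + 1) (A i m)
      = algebraMap ℝ R (μ i + μ (i + 1)) * A (i + 2) m - algebraMap ℝ R (μ (m + 1) + μ (m + 2))
        * (A i (m + 1) * A (i + 1) (m + 2) - A i (m + 2) * A (i + 1) (m + 1))) :
    ε • (A * (diagonal μ).map (algebraMap ℝ R) * Aᵀ) = (diagonal μ).map (algebraMap ℝ R) ∧
      ∀ i, A.map (δ i) = 0 := by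
  have hadjA := adjugate_eq_smul_transpose hA
  obtain ⟨S, hS⟩ : ∃ S, S = ε • (A * (diagonal μ).map (algebraMap ℝ R) * Aᵀ) := ⟨_, rfl⟩
  have hd := map_derivation_eq_crossMatrix_mul δ μ ε A hA (fun i m => by
    rw [hstr, adjugate_cyclic, hadjA, hdet, Matrix.smul_apply, transpose_apply, smul_eq_mul,
      map_sub, map_mul]
    ring) S hS
  have hadj := adjugate_eq_of_derivation_comm δ μ ε hcomm A hA S hS hd
  have hY := curvature_diff_mul_eq_zero δ μ ε hε A hA hdet S hS hadj hd
  have hsym : ∀ j q, S j q = S q j := fun j q => by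
    have : Sᵀ = S := by
      rw [hS]
      simp [transpose_mul, Matrix.mul_assoc, diagonal_map]
    exact congrFun (congrFun this q) j
  have hrow : ∀ j, μ (j + 2) * μ j - μ j * μ (j + 1) ≠ 0 →
      ∀ i, S j i = algebraMap ℝ R (diagonal μ j i) := fun j hj i => by
    refine eq_of_algebraMap_mul_eq hj ?_
    have := hY i j
    rw [mul_sub, sub_eq_zero] at this
    exact this
  have f1 : (1 : Fin 3) + 1 = 2 := rfl
  have f2 : (1 : Fin 3) + 2 = 0 := rfl
  have f3 : (2 : Fin 3) + 1 = 0 := rfl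
  have f4 : (2 : Fin 3) + 2 = 1 := rfl
  have s10 := hsym 1 0
  have s20 := hsym 2 0
  have s21 := hsym 2 1
  rw [adjugate_fin_three, adjugate_diagonal_fin_three] at hadj
  have ha := fun a b => congrFun (congrFun hadj a) b
  have hSM : S = (diagonal μ).map (algebraMap ℝ R) := by
    by_cases h12 : μ 1 = μ 2
    -- The Ricci tensor has a simple eigenvalue in the direction `0`, which gives the rows `1` and
    -- `2` of `S = M`; the remaining entry is read off from the adjugate.
    · have hm : μ 1 < 0 := by linarith
      have hne : μ 1 * (μ 0 - μ 1) ≠ 0 := mul_ne_zero hm.ne (by linarith)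
      have r1 := hrow 1 (by
        simp only [f1, f2, ← h12]
        intro h; apply hne; linarith)
      have r2 := hrow 2 (by
        simp only [f3, f4, ← h12]
        intro h; apply hne; linarith)
      have r10 := r1 0
      have r11 := r1 1
      have r12 := r1 2
      have r20 := r2 0
      have r22 := r2 2
      have a22 := ha 2 2
      simp [f3, f4] at r10 r11 r12 r20 r22 a22
      have s00 : S 0 0 = algebraMap ℝ R (μ 0) := by
        refine eq_of_algebraMap_mul_eq hm.ne ?_
        rw [r11, r10] at a22
        linear_combination a22
      ext a b
      fin_cases a <;> fin_cases b <;> simp <;> grind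
    -- The Ricci eigenvalues in the directions `1` and `2` differ, which gives the row `0` of
    -- `S = M`; the other entries are read off from the adjugate.
    · have r0 := hrow 0 (by
        simp only [zero_add]
        intro h
        have : μ 0 * (μ 2 - μ 1) = 0 := by linarith
        rcases mul_eq_zero.1 this with h | h
        · exact hμ0.ne' h
        · exact h12 (by linarith))
      have r00 := r0 0
      have r01 := r0 1
      have r02 := r0 2
      have a11 := ha 1 1
      have a22 := ha 2 2
      have a12 := ha 1 2
      simp [f1, f2, f3, f4] at r00 r01 r02 a11 a22 a12
      have s11 : S 1 1 = algebraMap ℝ R (μ 1) := by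
        refine eq_of_algebraMap_mul_eq hμ0.ne' ?_
        grind
      have s22 : S 2 2 = algebraMap ℝ R (μ 2) := by
        refine eq_of_algebraMap_mul_eq hμ0.ne' ?_
        grind
      have s12 : S 1 2 = 0 := by
        refine eq_of_algebraMap_mul_eq hμ0.ne' ?_
        grind
      ext a b
      fin_cases a <;> fin_cases b <;> simp <;> grind
  refine ⟨hS ▸ hSM, fun i => ?_⟩
  rw [hd, hSM]
  simp only [sub_self]
  rw [crossMatrix_zero, zero_mul]

end Algebra

/-! ### Smooth functions and left invariant derivations -/

/-- The algebra of smooth functions on `S̃l(2,ℝ)`. -/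
abbrev SmoothFun : Type := C^∞⟮modelSL, SLTilde; 𝓘(ℝ, ℝ), ℝ⟯

lemma lieD_smul_fun {F : Type*} [NormedAddCommGroup F] [NormedSpace ℝ F] (v : ℝ × ℂ)
    {f : SLTilde → ℝ} {G : SLTilde → F}
    (hf : ContMDiff modelSL 𝓘(ℝ, ℝ) ∞ f) (hG : ContMDiff modelSL 𝓘(ℝ, F) ∞ G) (x : SLTilde) :
    lieD v (fun y => f y • G y) x = lieD v f x • G x + f x • lieD v G x := by
  have h1 := (contDiffAt_retract_of_mem hf x).differentiableAt (by simp)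
  have h2 := (contDiffAt_retract_of_mem hG x).differentiableAt (by simp)
  have h3 : (fun y => f y • G y) ∘ retract = (f ∘ retract) • (G ∘ retract) := rfl
  rw [lieD, h3, fderiv_smul h1 h2]
  simp [lieD, retract_coe, add_comm]

lemma lieD_add_fun {F : Type*} [NormedAddCommGroup F] [NormedSpace ℝ F] (v : ℝ × ℂ)
    {f G : SLTilde → F}
    (hf : ContMDiff modelSL 𝓘(ℝ, F) ∞ f) (hG : ContMDiff modelSL 𝓘(ℝ, F) ∞ G) (x : SLTilde) :
    lieD v (fun y => f y + G y) x = lieD v f x + lieD v G x := by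
  have h1 := (contDiffAt_retract_of_mem hf x).differentiableAt (by simp)
  have h2 := (contDiffAt_retract_of_mem hG x).differentiableAt (by simp)
  have h3 : (fun y => f y + G y) ∘ retract = (f ∘ retract) + (G ∘ retract) := rfl
  rw [lieD, h3, fderiv_add h1 h2]
  simp [lieD]

lemma lieD_const {F : Type*} [NormedAddCommGroup F] [NormedSpace ℝ F] (v : ℝ × ℂ) (a : F)
    (x : SLTilde) : lieD v (fun _ => a) x = 0 := by
  have h3 : (fun _ : SLTilde => a) ∘ retract = fun _ => a := rfl
  rw [lieD, h3]; simp

/-- The derivation of the algebra of smooth functions defined by a left invariant vector field. -/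
def leftDerivation (v : ℝ × ℂ) : Derivation ℝ SmoothFun SmoothFun :=
  Derivation.mk'
    { toFun := fun f => ⟨lieD v f, contMDiff_lieD v f.contMDiff⟩
      map_add' := fun f g => by
        ext x
        exact lieD_add_fun v f.contMDiff g.contMDiff x
      map_smul' := fun a f => by
        ext x
        have h := lieD_smul_fun v (contMDiff_const (c := a)) f.contMDiff x
        rw [lieD_const, zero_smul, zero_add] at h
        exact h }
    (fun f g => by
      ext x
      have h := lieD_smul_fun v f.contMDiff g.contMDiff x
      change lieD v (fun y => f y • g y) x = f x * lieD v g x + g x * lieD v f x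
      rw [h]
      simp only [smul_eq_mul]
      ring)

lemma convex_lineTimesDisc : Convex ℝ (lineTimesDisc : Set (ℝ × ℂ)) := by
  have h : (lineTimesDisc : Set (ℝ × ℂ)) = (LinearMap.snd ℝ ℝ ℂ) ⁻¹' Metric.ball 0 1 := by
    ext p
    simp [lineTimesDisc]
  rw [h]
  exact (convex_ball _ _).linear_preimage _

instance : PreconnectedSpace SLTilde :=
  isPreconnected_iff_preconnectedSpace.1 convex_lineTimesDisc.isPreconnected

/-- A function whose derivatives along all left invariant fields vanish is constant, since `ℝ × D`
is convex. -/
lemma eq_of_lieD_eq_zero {F : Type*} [NormedAddCommGroup F] [NormedSpace ℝ F] {f : SLTilde → F}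
    (hf : ContMDiff modelSL 𝓘(ℝ, F) ∞ f) (h : ∀ v x, lieD v f x = 0) (x y : SLTilde) :
    f x = f y := by
  have h1 : ∀ p ∈ (lineTimesDisc : Set (ℝ × ℂ)),
      fderivWithin ℝ (f ∘ retract) lineTimesDisc p = 0 := by
    intro p hp
    rw [fderivWithin_of_isOpen lineTimesDisc.isOpen hp]
    refine ContinuousLinearMap.ext fun u => ?_
    have := h (coframe (⟨p, hp⟩ : SLTilde) u) ⟨p, hp⟩
    rw [lieD, leftField_coframe] at this
    exact this
  have h2 : DifferentiableOn ℝ (f ∘ retract) lineTimesDisc := fun p hp =>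
    ((contDiffAt_retract_of_mem hf ⟨p, hp⟩).differentiableAt (by simp)).differentiableWithinAt
  have := convex_lineTimesDisc.is_const_of_fderivWithin_eq_zero h2 h1 x.2 y.2
  simpa [retract_coe] using this

/-! ### The rescaled frame -/

/-- The rescaled standard basis `c_i E_i` in the coordinates of `ℝ × ℂ`. -/
def scaledBasis (c : Fin 3 → ℝ) (i : Fin 3) : ℝ × ℂ :=
  c i • (![((1, 0) : ℝ × ℂ), ((0, 1 / 2) : ℝ × ℂ), ((0, Complex.I / 2) : ℝ × ℂ)] i)

/-- The coordinates with respect to the rescaled standard basis. -/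
def scaledCoord (c : Fin 3 → ℝ) (i : Fin 3) (v : ℝ × ℂ) : ℝ :=
  ![v.1, 2 * v.2.re, 2 * v.2.im] i / c i

/-- The structure constants of the rescaled basis: `[b_i, b_{i+1}] = n_{i+2} b_{i+2}`. -/
def structN (c : Fin 3 → ℝ) : Fin 3 → ℝ :=
  ![-(c 1 * c 2 / c 0), c 2 * c 0 / c 1, c 0 * c 1 / c 2]

/-- The coefficients in `∇_{b_i} b_j = μ_i b_i × b_j` of the Levi-Civita connection for which the
rescaled basis is orthonormal. -/
def connCoeff (c : Fin 3 → ℝ) (i : Fin 3) : ℝ :=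
  (structN c (i + 1) + structN c (i + 2) - structN c i) / 2

lemma connCoeff_add (c : Fin 3 → ℝ) (i : Fin 3) :
    connCoeff c i + connCoeff c (i + 1) = structN c (i + 2) := by
  fin_cases i <;> simp [connCoeff, show (1 : Fin 3) + 1 = 2 from rfl,
    show (1 : Fin 3) + 2 = 0 from rfl, show (2 : Fin 3) + 1 = 0 from rfl,
    show (2 : Fin 3) + 2 = 1 from rfl] <;> ring

lemma sum_scaledCoord {c : Fin 3 → ℝ} (hc : ∀ i, c i ≠ 0) (v : ℝ × ℂ) :
    ∑ i, scaledCoord c i v • scaledBasis c i = v := by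
  have h0 := hc 0
  have h1 := hc 1
  have h2 := hc 2
  refine Prod.ext ?_ (Complex.ext ?_ ?_)
  all_goals simp [Fin.sum_univ_three, scaledCoord, scaledBasis]
  all_goals field_simp

lemma scaledCoord_sum {c : Fin 3 → ℝ} (hc : ∀ i, c i ≠ 0) (t : Fin 3 → ℝ) (j : Fin 3) :
    scaledCoord c j (∑ i, t i • scaledBasis c i) = t j := by
  have h0 := hc 0
  have h1 := hc 1
  have h2 := hc 2
  fin_cases j
  all_goals simp [Fin.sum_univ_three, scaledCoord, scaledBasis]
  all_goals field_simp

lemma brk_scaledBasis {c : Fin 3 → ℝ} (hc : ∀ i, c i ≠ 0) (i : Fin 3) :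
    brk (scaledBasis c i) (scaledBasis c (i + 1))
      = structN c (i + 2) • scaledBasis c (i + 2) := by
  have h0 := hc 0
  have h1 := hc 1
  have h2 := hc 2
  fin_cases i
  all_goals
    simp only [scaledBasis, brk, structN]
    refine Prod.ext ?_ (Complex.ext ?_ ?_)
  all_goals simp
  all_goals field_simp
  all_goals norm_num

/-! ### The structure equation of a diffeomorphism -/

section StructureEquation

lemma contMDiff_scaledCoord (c : Fin 3 → ℝ) (j : Fin 3) {f : SLTilde → ℝ × ℂ}
    (hf : ContMDiff modelSL modelSL ∞ f) :
    ContMDiff modelSL 𝓘(ℝ, ℝ) ∞ (fun x => scaledCoord c j (f x)) := by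
  have h : ContDiff ℝ ∞ (scaledCoord c j) := by
    unfold scaledCoord
    refine ContDiff.div_const ?_ _
    fin_cases j
    · exact contDiff_fst
    · exact contDiff_const.mul (Complex.reCLM.contDiff.comp contDiff_snd)
    · exact contDiff_const.mul (Complex.imCLM.contDiff.comp contDiff_snd)
  exact h.contMDiff.comp hf

/-- The matrix of the differential of `φ` with respect to the rescaled left invariant frame. -/
def frameMatrix (c : Fin 3 → ℝ) {φ : SLTilde → SLTilde} (hφ : ContMDiff modelSL modelSL ∞ φ) :
    Matrix (Fin 3) (Fin 3) SmoothFun := fun i j =>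
  ⟨fun x => scaledCoord c j (frameMap φ (scaledBasis c i) x),
    contMDiff_scaledCoord c j (contMDiff_frameMap hφ _)⟩

variable {c : Fin 3 → ℝ} {φ : SLTilde → SLTilde}

lemma frameMap_scaledBasis (hc : ∀ i, c i ≠ 0) (hφ : ContMDiff modelSL modelSL ∞ φ) (i : Fin 3)
    (x : SLTilde) :
    frameMap φ (scaledBasis c i) x = ∑ j, frameMatrix c hφ i j x • scaledBasis c j :=
  (sum_scaledCoord hc _).symm

lemma lieD_incl (v : ℝ × ℂ) (x : SLTilde) : lieD v incl x = leftField v x := by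
  have h : incl ∘ retract =ᶠ[nhds (x : ℝ × ℂ)] id := coe_retract_eventuallyEq x
  rw [lieD, h.fderiv_eq, fderiv_id]
  rfl

lemma contMDiff_leftField_comp (v : ℝ × ℂ) :
    ContMDiff modelSL modelSL ∞ (fun y : SLTilde => leftField v y) :=
  (contDiff_leftField v).contMDiff.comp contMDiff_incl

lemma leftField_sum (t : Fin 3 → ℝ) (b : Fin 3 → ℝ × ℂ) (p : ℝ × ℂ) :
    leftField (∑ i, t i • b i) p = ∑ i, t i • leftField (b i) p := by
  simp [Fin.sum_univ_three, leftField_add, leftField_smul]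

lemma lieD_sum {F : Type*} [NormedAddCommGroup F] [NormedSpace ℝ F] (t : Fin 3 → ℝ)
    (b : Fin 3 → ℝ × ℂ) (f : SLTilde → F) (x : SLTilde) :
    lieD (∑ i, t i • b i) f x = ∑ i, t i • lieD (b i) f x := by
  simp [Fin.sum_univ_three, lieD_add, lieD_smul]

lemma leftDerivation_comm (hc : ∀ i, c i ≠ 0) (i : Fin 3) (f : SmoothFun) :
    leftDerivation (scaledBasis c i) (leftDerivation (scaledBasis c (i + 1)) f)
      - leftDerivation (scaledBasis c (i + 1)) (leftDerivation (scaledBasis c i) f)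
      = algebraMap ℝ SmoothFun (structN c (i + 2)) * leftDerivation (scaledBasis c (i + 2)) f := by
  ext x
  have h := lieD_comm (scaledBasis c i) (scaledBasis c (i + 1)) f.contMDiff x
  rw [brk_scaledBasis hc, lieD_smul] at h
  exact h

lemma lieD_lieD_incl_comp (hc : ∀ i, c i ≠ 0) (hφ : ContMDiff modelSL modelSL ∞ φ) (i j : Fin 3)
    (x : SLTilde) :
    lieD (scaledBasis c i) (lieD (scaledBasis c j) (incl ∘ φ)) x
      = ∑ k, (leftDerivation (scaledBasis c i) (frameMatrix c hφ j k) x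
          • leftField (scaledBasis c k) (φ x)
        + frameMatrix c hφ j k x • ∑ l, frameMatrix c hφ i l x
          • lieD (scaledBasis c l) (fun y => leftField (scaledBasis c k) y) (φ x)) := by
  have h1 : lieD (scaledBasis c j) (incl ∘ φ) = fun y =>
      ∑ k, frameMatrix c hφ j k y • leftField (scaledBasis c k) (φ y) := by
    funext y
    rw [← leftField_frameMap, frameMap_scaledBasis hc hφ, leftField_sum]
  have hG : ∀ k, ContMDiff modelSL modelSL ∞
      (fun y : SLTilde => leftField (scaledBasis c k) (φ y)) :=
    fun k => (contMDiff_leftField_comp _).comp hφ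
  have hA : ∀ k, ContMDiff modelSL 𝓘(ℝ, ℝ) ∞ (fun y => frameMatrix c hφ j k y) :=
    fun k => (frameMatrix c hφ j k).contMDiff
  have hAG : ∀ k, ContMDiff modelSL modelSL ∞
      (fun y => frameMatrix c hφ j k y • leftField (scaledBasis c k) (φ y)) :=
    fun k => (hA k).smul (hG k)
  have hAG01 : ContMDiff modelSL modelSL ∞
      (fun y => frameMatrix c hφ j 0 y • leftField (scaledBasis c 0) (φ y)
        + frameMatrix c hφ j 1 y • leftField (scaledBasis c 1) (φ y)) := (hAG 0).add (hAG 1)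
  have h2 : ∀ k, lieD (scaledBasis c i)
      (fun y => frameMatrix c hφ j k y • leftField (scaledBasis c k) (φ y)) x
      = leftDerivation (scaledBasis c i) (frameMatrix c hφ j k) x
          • leftField (scaledBasis c k) (φ x)
        + frameMatrix c hφ j k x • ∑ l, frameMatrix c hφ i l x
          • lieD (scaledBasis c l) (fun y => leftField (scaledBasis c k) y) (φ x) := by
    intro k
    rw [lieD_smul_fun _ (hA k) (hG k)]
    congr 2
    have := lieD_comp hφ (contMDiff_leftField_comp (scaledBasis c k)) (scaledBasis c i) x
    rw [frameMap_scaledBasis hc hφ, lieD_sum] at this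
    exact this
  rw [h1]
  simp only [Fin.sum_univ_three]
  rw [lieD_add_fun _ hAG01 (hAG 2), lieD_add_fun _ (hAG 0) (hAG 1), h2, h2, h2]
  simp only [Fin.sum_univ_three]

/-- The structure equation: `φ` maps the brackets of the left invariant fields to the brackets of
their images. -/
lemma frameMatrix_structure_equation (hc : ∀ i, c i ≠ 0) (hφ : ContMDiff modelSL modelSL ∞ φ)
    (i m : Fin 3) :
    leftDerivation (scaledBasis c i) (frameMatrix c hφ (i + 1) m)
        - leftDerivation (scaledBasis c (i + 1)) (frameMatrix c hφ i m)
      = algebraMap ℝ SmoothFun (structN c (i + 2)) * frameMatrix c hφ (i + 2) m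
        - algebraMap ℝ SmoothFun (structN c m)
          * (frameMatrix c hφ i (m + 1) * frameMatrix c hφ (i + 1) (m + 2)
            - frameMatrix c hφ i (m + 2) * frameMatrix c hφ (i + 1) (m + 1)) := by
  ext x
  -- Both sides are compared through the vector fields on `ℝ × ℂ`: the `H l k` are the derivatives
  -- of the left invariant fields at `φ x`, and only their commutators `h2` enter.
  set A : Fin 3 → Fin 3 → ℝ := fun j k => frameMatrix c hφ j k x with hA
  set d : Fin 3 → Fin 3 → Fin 3 → ℝ :=
    fun i j k => leftDerivation (scaledBasis c i) (frameMatrix c hφ j k) x with hd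
  set G : Fin 3 → ℝ × ℂ := fun k => leftField (scaledBasis c k) (φ x) with hG
  set H : Fin 3 → Fin 3 → ℝ × ℂ := fun l k =>
    lieD (scaledBasis c l) (fun y => leftField (scaledBasis c k) y) (φ x) with hH
  have h0 := lieD_comm (scaledBasis c i) (scaledBasis c (i + 1)) (contMDiff_incl.comp hφ) x
  have h1 : lieD (brk (scaledBasis c i) (scaledBasis c (i + 1))) (incl ∘ φ) x
      = structN c (i + 2) • ∑ k, A (i + 2) k • G k := by
    rw [brk_scaledBasis hc, lieD_smul, ← leftField_frameMap, frameMap_scaledBasis hc hφ,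
      leftField_sum]
  rw [h1, lieD_lieD_incl_comp hc hφ, lieD_lieD_incl_comp hc hφ] at h0
  have h2 : ∀ l, H l (l + 1) - H (l + 1) l = structN c (l + 2) • G (l + 2) := by
    intro l
    have h := lieD_comm (scaledBasis c l) (scaledBasis c (l + 1)) contMDiff_incl (φ x)
    have e : ∀ v, lieD v incl = fun y : SLTilde => leftField v y := fun v => funext (lieD_incl v)
    rw [e, e, brk_scaledBasis hc, lieD_incl, leftField_smul] at h
    exact h
  have h3 : ∑ k, (d i (i + 1) k - d (i + 1) i k - structN c (i + 2) * A (i + 2) k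
      + structN c k * (A i (k + 1) * A (i + 1) (k + 2) - A i (k + 2) * A (i + 1) (k + 1)))
        • G k = 0 := by
    have f1 : (1 : Fin 3) + 1 = 2 := rfl
    have f2 : (1 : Fin 3) + 2 = 0 := rfl
    have f3 : (2 : Fin 3) + 1 = 0 := rfl
    have f4 : (2 : Fin 3) + 2 = 1 := rfl
    have e0 := h2 0
    have e1 := h2 1
    have e2 := h2 2
    change (∑ k, (d i (i + 1) k • G k + A (i + 1) k • ∑ l, A i l • H l k))
      - (∑ k, (d (i + 1) i k • G k + A i k • ∑ l, A (i + 1) l • H l k)) = _ at h0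
    simp only [Fin.sum_univ_three, f1, f2, f3, f4, zero_add] at h0 e0 e1 e2 ⊢
    linear_combination (norm := module) h0
      - (A i 0 * A (i + 1) 1 - A i 1 * A (i + 1) 0) • e0
      - (A i 1 * A (i + 1) 2 - A i 2 * A (i + 1) 1) • e1
      - (A i 2 * A (i + 1) 0 - A i 0 * A (i + 1) 2) • e2
  have h4 := congrArg (coframe (φ x)) h3
  rw [hG, ← leftField_sum, coframe_leftField] at h4
  have h5 := congrArg (scaledCoord c m) h4
  rw [scaledCoord_sum hc] at h5
  have h6 : scaledCoord c m (coframe (φ x) 0) = 0 := by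
    have : coframe (φ x) 0 = 0 := by simp [coframe]
    rw [this]
    fin_cases m <;> simp [scaledCoord]
  rw [h6] at h5
  change d i (i + 1) m - d (i + 1) i m = structN c (i + 2) * A (i + 2) m - structN c m *
    (A i (m + 1) * A (i + 1) (m + 2) - A i (m + 2) * A (i + 1) (m + 1))
  linarith

end StructureEquation

section LeftInvariantTensors

/-! ### Left invariant tensors -/

/-- The value at the identity of a covariant `2`-tensor field, in the coordinates of `ℝ × ℂ`. -/
def atOne (h : CovTensor) : (ℝ × ℂ) →L[ℝ] (ℝ × ℂ) →L[ℝ] ℝ := h 1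

lemma apply_mulInvariantVectorField {h : CovTensor} (hinv : IsLeftInvariant h) (y : SLTilde)
    (v w : LieSL) :
    h y (mulInvariantVectorField v y) (mulInvariantVectorField w y) = atOne h v w := by
  have key : ∀ z, z = y → ∀ a b : ℝ × ℂ, (h z : (ℝ × ℂ) →L[ℝ] (ℝ × ℂ) →L[ℝ] ℝ) a b
      = (h y : (ℝ × ℂ) →L[ℝ] (ℝ × ℂ) →L[ℝ] ℝ) a b := by
    rintro z rfl a b; rfl
  exact (key (y * 1) (mul_one y) _ _).symm.trans (hinv y 1 v w)

/-- An isometry of a left invariant tensor preserves its value at the identity, when its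
differential is expressed in the left invariant trivialisation. -/
lemma atOne_frameMap {h : CovTensor} (hinv : IsLeftInvariant h) {φ : SLTilde → SLTilde}
    (hφ : ContMDiff modelSL modelSL ∞ φ) (hp : Preserves φ h) (v w : ℝ × ℂ) (x : SLTilde) :
    atOne h (frameMap φ v x) (frameMap φ w x) = atOne h v w := by
  have h1 := hp x (mulInvariantVectorField (v : LieSL) x) (mulInvariantVectorField (w : LieSL) x)
  have h2 := apply_mulInvariantVectorField hinv x (v : LieSL) (w : LieSL)
  have h3 := apply_mulInvariantVectorField hinv (φ x) (frameMap φ v x : LieSL)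
    (frameMap φ w x : LieSL)
  rw [pullbackEval] at h1
  have e := fun u : LieSL => mfderiv_mulInvariantVectorField hφ u x
  have e1 := e v
  have e2 := e w
  rw [e1, e2] at h1
  exact h3.symm.trans (h1.trans h2)

lemma atOne_sum (h : CovTensor) (s t : Fin 3 → ℝ) (b : Fin 3 → ℝ × ℂ) :
    atOne h (∑ i, s i • b i) (∑ j, t j • b j) = ∑ i, ∑ j, s i * t j * atOne h (b i) (b j) := by
  simp only [map_sum, map_smul, _root_.sum_apply, _root_.smul_apply,
    smul_eq_mul, Finset.mul_sum]
  rw [Finset.sum_comm]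
  exact Finset.sum_congr rfl fun i _ => Finset.sum_congr rfl fun j _ => by ring

lemma connCoeff_zero_pos {c : Fin 3 → ℝ} (hc : ∀ i, 0 < c i) : 0 < connCoeff c 0 := by
  have h0 := hc 0
  have h1 := hc 1
  have h2 := hc 2
  have : 0 < c 1 * c 2 / c 0 := by positivity
  have : 0 < c 2 * c 0 / c 1 := by positivity
  have : 0 < c 0 * c 1 / c 2 := by positivity
  simp [connCoeff, structN]
  linarith

lemma connCoeff_one_add_two_neg {c : Fin 3 → ℝ} (hc : ∀ i, 0 < c i) :
    connCoeff c 1 + connCoeff c 2 < 0 := by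
  have h0 := hc 0
  have h1 := hc 1
  have h2 := hc 2
  have h3 : 0 < c 1 * c 2 / c 0 := by positivity
  have h : connCoeff c 1 + connCoeff c 2 = structN c 0 := connCoeff_add c 1
  rw [h]
  simpa [structN] using h3

variable {c : Fin 3 → ℝ} {φ : SLTilde → SLTilde}

/-- On a connected manifold a smooth function with values `±1` is constant. -/
lemma eq_algebraMap_of_sq_eq_one (f : SmoothFun) (hf : f ^ 2 = 1) :
    ∃ ε : ℝ, ε ^ 2 = 1 ∧ f = algebraMap ℝ SmoothFun ε := by
  have hsq : ∀ x, f x ^ 2 = 1 := fun x => congrArg (fun h : SmoothFun => h x) hf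
  have h := isPreconnected_univ.eq_or_eq_neg_of_sq_eq (f := fun x => f x)
    (g := fun _ : SLTilde => (1 : ℝ)) f.contMDiff.continuous.continuousOn continuousOn_const
    (fun x _ => by simpa using hsq x) (fun _ => one_ne_zero)
  rcases h with h | h
  · refine ⟨1, by norm_num, ?_⟩
    ext x
    exact h (Set.mem_univ x)
  · refine ⟨-1, by norm_num, ?_⟩
    ext x
    exact h (Set.mem_univ x)

lemma frameMatrix_mul_transpose (hc : ∀ i, c i ≠ 0) {h : CovTensor} (hinv : IsLeftInvariant h)
    (hφ : ContMDiff modelSL modelSL ∞ φ) (hp : Preserves φ h) (t : Fin 3 → ℝ)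
    (hh : ∀ i j, atOne h (scaledBasis c i) (scaledBasis c j) = if i = j then t i else 0) :
    frameMatrix c hφ * (diagonal t).map (algebraMap ℝ SmoothFun) * (frameMatrix c hφ)ᵀ
      = (diagonal t).map (algebraMap ℝ SmoothFun) := by
  ext i j x
  have h1 := atOne_frameMap hinv hφ hp (scaledBasis c i) (scaledBasis c j) x
  rw [frameMap_scaledBasis hc hφ, frameMap_scaledBasis hc hφ, atOne_sum, hh] at h1
  simp only [hh, mul_ite, mul_zero, Finset.sum_ite_eq, Finset.mem_univ, if_true] at h1
  have e : ∀ a b, (diagonal t).map (algebraMap ℝ SmoothFun) a b x = if a = b then t a else 0 := by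
    intro a b
    rw [map_apply, diagonal_apply]
    split <;> rfl
  rw [e, ← h1, diagonal_map (by simp)]
  rw [mul_apply]
  simp only [mul_diagonal, transpose_apply, Fin.sum_univ_three]
  change frameMatrix c hφ i 0 x * t 0 * frameMatrix c hφ j 0 x
    + frameMatrix c hφ i 1 x * t 1 * frameMatrix c hφ j 1 x
    + frameMatrix c hφ i 2 x * t 2 * frameMatrix c hφ j 2 x = _
  ring

/-- With respect to the rescaled frame the differential of an isometry is constant, orthogonal, and
commutes up to the sign of its determinant with the connection coefficients. -/
theorem exists_const_frameMatrix (hc : ∀ i, 0 < c i) {h : CovTensor} (hinv : IsLeftInvariant h)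
    (horth : ∀ i j, atOne h (scaledBasis c i) (scaledBasis c j) = if i = j then 1 else 0)
    (hφ : ContMDiff modelSL modelSL ∞ φ) (hp : Preserves φ h) :
    ∃ (A : Matrix (Fin 3) (Fin 3) ℝ) (ε : ℝ), A * Aᵀ = 1 ∧ ε ^ 2 = 1 ∧ A.det = ε ∧
      ε • (A * diagonal (connCoeff c) * Aᵀ) = diagonal (connCoeff c) ∧
      ∀ i x, frameMap φ (scaledBasis c i) x = ∑ j, A i j • scaledBasis c j := by
  have hc0 : ∀ i, c i ≠ 0 := fun i => (hc i).ne'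
  set A := frameMatrix c hφ with hA
  have hAA : A * Aᵀ = 1 := by
    have h1 := frameMatrix_mul_transpose hc0 hinv hφ hp (fun _ => 1) horth
    simpa [diagonal_map] using h1
  obtain ⟨ε, hε, hdet⟩ := eq_algebraMap_of_sq_eq_one A.det (by
    have := congrArg det hAA
    rwa [det_mul, det_transpose, det_one, ← sq] at this)
  obtain ⟨hM, hd⟩ := map_derivation_eq_zero_of_structure_equation
    (fun i => leftDerivation (scaledBasis c i)) (connCoeff c) (connCoeff_zero_pos hc)
    (connCoeff_one_add_two_neg hc) ε hε
    (fun i f => by rw [connCoeff_add]; exact leftDerivation_comm hc0 i f) A hAA hdet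
    (fun i m => by
      have e : connCoeff c (m + 1) + connCoeff c (m + 2) = structN c m := by
        have := connCoeff_add c (m + 1)
        have e1 : m + 1 + 1 = m + 2 := by rw [add_assoc]; rfl
        have e2 : m + 1 + 2 = m := by rw [add_assoc]; exact add_zero m
        rwa [e1, e2] at this
      rw [connCoeff_add, e]
      exact frameMatrix_structure_equation hc0 hφ i m)
  have hconst : ∀ i j x, A i j x = A i j 1 := by
    intro i j x
    refine eq_of_lieD_eq_zero (A i j).contMDiff (fun v y => ?_) x 1
    rw [← sum_scaledCoord hc0 v, lieD_sum]
    refine Finset.sum_eq_zero fun k _ => ?_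
    have h1 := congrArg (fun f : SmoothFun => f y) (congrFun (congrFun (hd k) i) j)
    change lieD (scaledBasis c k) (A i j) y = 0 at h1
    rw [h1, smul_zero]
  -- evaluation at the identity
  let ev : SmoothFun →+* ℝ :=
    { toFun := fun f => f 1
      map_one' := rfl
      map_mul' := fun _ _ => rfl
      map_zero' := rfl
      map_add' := fun _ _ => rfl }
  have hev : ∀ r : ℝ, ev (algebraMap ℝ SmoothFun r) = r := fun _ => rfl
  have hevd : ((diagonal (connCoeff c)).map (algebraMap ℝ SmoothFun)).map ev
      = diagonal (connCoeff c) := by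
    ext i j
    exact hev _
  refine ⟨A.map ev, ε, ?_, hε, ?_, ?_, fun i x => ?_⟩
  · have := congrArg (fun B : Matrix (Fin 3) (Fin 3) SmoothFun => B.map ev) hAA
    simpa [Matrix.map_mul, transpose_map] using this
  · have := congrArg ev hdet
    rw [hev, ev.map_det] at this
    exact this
  · have h1 := congrArg (fun B : Matrix (Fin 3) (Fin 3) SmoothFun => B.map ev) hM
    rw [← algebraMap_smul SmoothFun ε] at h1
    have h2 : ∀ B : Matrix (Fin 3) (Fin 3) SmoothFun,
        (algebraMap ℝ SmoothFun ε • B).map ev = ε • B.map ev := fun B => by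
      ext i j
      exact map_mul ev _ _
    simp only [h2, Matrix.map_mul, hevd, transpose_map] at h1
    exact h1
  · rw [frameMap_scaledBasis hc0 hφ]
    exact Finset.sum_congr rfl fun j _ => by rw [← hA, hconst]; rfl

end LeftInvariantTensors

/-! ### Diffeomorphisms with a prescribed differential -/

lemma coframe_add (x : SLTilde) (u w : ℝ × ℂ) : coframe x (u + w) = coframe x u + coframe x w := by
  refine Prod.ext ?_ ?_
  · simp [coframe, add_div, mul_add]; ring
  · simp [coframe, add_div, mul_add]

lemma coframe_smul (x : SLTilde) (a : ℝ) (u : ℝ × ℂ) : coframe x (a • u) = a • coframe x u := by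
  have h := leftField_smul a (coframe x u) x
  rw [leftField_coframe] at h
  rw [← h, coframe_leftField]

lemma frameMap_add (φ : SLTilde → SLTilde) (v w : ℝ × ℂ) (x : SLTilde) :
    frameMap φ (v + w) x = frameMap φ v x + frameMap φ w x := by
  rw [frameMap, lieD_add, coframe_add]; rfl

lemma frameMap_smul (φ : SLTilde → SLTilde) (a : ℝ) (v : ℝ × ℂ) (x : SLTilde) :
    frameMap φ (a • v) x = a • frameMap φ v x := by
  rw [frameMap, lieD_smul, coframe_smul]; rfl

lemma frameMap_sum (φ : SLTilde → SLTilde) (t : Fin 3 → ℝ) (b : Fin 3 → ℝ × ℂ) (x : SLTilde) :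
    frameMap φ (∑ i, t i • b i) x = ∑ i, t i • frameMap φ (b i) x := by
  simp [Fin.sum_univ_three, frameMap_add, frameMap_smul]

lemma frameMap_comp {φ ψ : SLTilde → SLTilde} (hφ : ContMDiff modelSL modelSL ∞ φ)
    (hψ : ContMDiff modelSL modelSL ∞ ψ) (v : ℝ × ℂ) (x : SLTilde) :
    frameMap (φ ∘ ψ) v x = frameMap φ (frameMap ψ v x) (ψ x) := by
  have h := lieD_comp hψ (contMDiff_incl.comp hφ) v x
  rw [frameMap, ← Function.comp_assoc, h]; rfl

lemma frameMap_id (v : ℝ × ℂ) (x : SLTilde) : frameMap id v x = v := by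
  rw [frameMap, Function.comp_id, lieD_incl]
  exact coframe_leftField x v

lemma leftField_one (v : ℝ × ℂ) : leftField v ((1 : SLTilde) : ℝ × ℂ) = v := by
  simp [leftField, coe_one, phase]

lemma contMDiff_leftMul (a : SLTilde) : ContMDiff modelSL modelSL ∞ (fun x : SLTilde => a * x) :=
  contMDiff_mul_left

lemma frameMap_leftMul_one (a : SLTilde) (v : ℝ × ℂ) : frameMap (fun x => a * x) v 1 = v := by
  have h3 : ((incl ∘ fun y : SLTilde => a * y) ∘ retract) =ᶠ[nhds ((1 : SLTilde) : ℝ × ℂ)]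
      mulAux (a : ℝ × ℂ) := by
    filter_upwards [lineTimesDisc_mem_nhds 1] with p hp
    simp only [Function.comp, incl, coe_mul, coe_retract hp]
  have h : lieD v (incl ∘ fun y : SLTilde => a * y) 1 = leftField v a := by
    rw [lieD, h3.fderiv_eq, leftField_one]
    exact fderiv_mulAux a v
  rw [frameMap, h, mul_one, coframe_leftField]

lemma frameMap_leftMul (a : SLTilde) (v : ℝ × ℂ) (x : SLTilde) :
    frameMap (fun x => a * x) v x = v := by
  have h := frameMap_comp (contMDiff_leftMul a) (contMDiff_leftMul x) v 1
  rw [frameMap_leftMul_one, mul_one] at h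
  have e : (fun y => a * y) ∘ (fun y => x * y) = fun y : SLTilde => (a * x) * y :=
    funext fun y => (mul_assoc a x y).symm
  rw [← h, e, frameMap_leftMul_one]

lemma fderiv_comp_retract_eq {φ ψ : SLTilde → SLTilde} {x : SLTilde} (h0 : φ x = ψ x)
    (h : ∀ v, frameMap φ v x = frameMap ψ v x) :
    fderiv ℝ ((incl ∘ φ) ∘ retract) (x : ℝ × ℂ) = fderiv ℝ ((incl ∘ ψ) ∘ retract) x := by
  refine ContinuousLinearMap.ext fun u => ?_
  rw [← leftField_coframe x u]
  have h1 := leftField_frameMap φ (coframe x u) x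
  have h2 := leftField_frameMap ψ (coframe x u) x
  rw [h, h0, h2] at h1
  exact h1.symm

/-- The quotient `(p, q) ↦ p q⁻¹` in the coordinates of `ℝ × ℂ`. -/
def divAux (x : (ℝ × ℂ) × (ℝ × ℂ)) : ℝ × ℂ :=
  mulAux x.1 (-x.2.1, -(phase (-x.2.1) * x.2.2))

lemma differentiableAt_divAux (x y : SLTilde) :
    DifferentiableAt ℝ divAux ((x : ℝ × ℂ), (y : ℝ × ℂ)) := by
  have hi : ContDiff ℝ ∞ fun p : ℝ × ℂ => ((-p.1, -(phase (-p.1) * p.2)) : ℝ × ℂ) :=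
    contDiff_fst.neg.prodMk ((contDiff_phase.comp contDiff_fst.neg).mul contDiff_snd).neg
  have h1 := contDiffAt_mulAux ((x : ℝ × ℂ), ((y⁻¹ : SLTilde) : ℝ × ℂ)) x.2 (y⁻¹).2
  have h2 : ContDiff ℝ ∞ fun p : (ℝ × ℂ) × (ℝ × ℂ) =>
      (p.1, ((-p.2.1, -(phase (-p.2.1) * p.2.2)) : ℝ × ℂ)) :=
    contDiff_fst.prodMk (hi.comp contDiff_snd)
  exact (h1.comp ((x : ℝ × ℂ), (y : ℝ × ℂ)) h2.contDiffAt).differentiableAt (by simp)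

lemma divAux_coe (x y : SLTilde) : divAux ((x : ℝ × ℂ), (y : ℝ × ℂ)) = incl (x * y⁻¹) := rfl

/-- A diffeomorphism which maps every left invariant vector field to itself is a left translation:
the function `x ↦ φ(x) x⁻¹` has the same derivative at each point as the corresponding function of a
left translation, for which it is constant. -/
lemma eq_leftMul_of_frameMap_eq {φ : SLTilde → SLTilde} (hφ : ContMDiff modelSL modelSL ∞ φ)
    (h : ∀ v x, frameMap φ v x = v) (x : SLTilde) : φ x = φ 1 * x := by
  have hsm : ContMDiff modelSL modelSL ∞ (fun x => φ x * x⁻¹) :=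
    hφ.mul (contMDiff_inv modelSL ∞)
  have hf : ∀ ψ : SLTilde → SLTilde, ContMDiff modelSL modelSL ∞ ψ → ∀ x : SLTilde,
      HasFDerivAt ((incl ∘ fun x => ψ x * x⁻¹) ∘ retract)
        ((fderiv ℝ divAux ((ψ x : ℝ × ℂ), (x : ℝ × ℂ))).comp
          ((fderiv ℝ ((incl ∘ ψ) ∘ retract) (x : ℝ × ℂ)).prod
            (ContinuousLinearMap.id ℝ (ℝ × ℂ)))) (x : ℝ × ℂ) := by
    intro ψ hψ x
    have h1 : HasFDerivAt ((incl ∘ ψ) ∘ retract) (fderiv ℝ ((incl ∘ ψ) ∘ retract) (x : ℝ × ℂ))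
        (x : ℝ × ℂ) :=
      ((contDiffAt_retract_of_mem (contMDiff_incl.comp hψ) x).differentiableAt
        (by simp)).hasFDerivAt
    have h2 : HasFDerivAt (fun p => (((incl ∘ ψ) ∘ retract) p, id p)) _ (x : ℝ × ℂ) :=
      h1.prodMk (hasFDerivAt_id (x : ℝ × ℂ))
    have h3 : HasFDerivAt divAux (fderiv ℝ divAux ((ψ x : ℝ × ℂ), (x : ℝ × ℂ)))
        (((incl ∘ ψ) ∘ retract) (x : ℝ × ℂ), id (x : ℝ × ℂ)) := by
      have : ((incl ∘ ψ) ∘ retract) (x : ℝ × ℂ) = ψ x := by simp [retract_coe, incl]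
      rw [this]
      exact (differentiableAt_divAux (ψ x) x).hasFDerivAt
    have h4 := HasFDerivAt.comp (g := divAux)
      (f := fun p => (((incl ∘ ψ) ∘ retract) p, id p)) (x : ℝ × ℂ) h3 h2
    refine h4.congr_of_eventuallyEq ?_
    filter_upwards [lineTimesDisc_mem_nhds x] with p hp
    simp only [Function.comp]
    rw [← divAux_coe, coe_retract hp]
    rfl
  have hz : ∀ v x, lieD v (incl ∘ fun x => φ x * x⁻¹) x = 0 := by
    intro v x
    have h1 := hf φ hφ x
    have h2 := hf (fun y => (φ x * x⁻¹) * y) (contMDiff_leftMul _) x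
    have e : φ x * x⁻¹ * x = φ x := inv_mul_cancel_right _ _
    have e2 : (incl ∘ fun y => φ x * x⁻¹ * y * y⁻¹) ∘ retract = fun _ => incl (φ x * x⁻¹) :=
      funext fun p => by simp [mul_assoc]
    rw [e2] at h2
    have h3 := h2.unique (hasFDerivAt_const _ _)
    rw [e, ← fderiv_comp_retract_eq (φ := φ) e.symm (fun v => by rw [h, frameMap_leftMul])] at h3
    rw [h3] at h1
    rw [lieD, h1.fderiv]
    rfl
  have := eq_of_lieD_eq_zero (contMDiff_incl.comp hsm) hz x 1
  have h2 : φ x * x⁻¹ = φ 1 := by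
    have h3 : φ x * x⁻¹ = φ 1 * 1⁻¹ := Subtype.ext this
    rwa [inv_one, mul_one] at h3
  rw [← h2, inv_mul_cancel_right]

/-- `φ` maps the `i`-th field of the rescaled left invariant frame to the constant linear
combination `∑ j, A i j b_j` of that frame. -/
def HasFrameMatrix (c : Fin 3 → ℝ) (φ : SLTilde → SLTilde) (A : Matrix (Fin 3) (Fin 3) ℝ) : Prop :=
  ∀ i x, frameMap φ (scaledBasis c i) x = ∑ j, A i j • scaledBasis c j

lemma HasFrameMatrix.frameMap_eq {c : Fin 3 → ℝ} (hc : ∀ i, c i ≠ 0) {φ ψ : SLTilde → SLTilde}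
    {A : Matrix (Fin 3) (Fin 3) ℝ} (hφ : HasFrameMatrix c φ A) (hψ : HasFrameMatrix c ψ A)
    (v : ℝ × ℂ) (x y : SLTilde) : frameMap φ v x = frameMap ψ v y := by
  rw [← sum_scaledCoord hc v, frameMap_sum, frameMap_sum]
  exact Finset.sum_congr rfl fun i _ => by rw [hφ, hψ]

lemma HasFrameMatrix.comp {c : Fin 3 → ℝ} {φ ψ : SLTilde → SLTilde}
    (hφs : ContMDiff modelSL modelSL ∞ φ) (hψs : ContMDiff modelSL modelSL ∞ ψ)
    {A B : Matrix (Fin 3) (Fin 3) ℝ} (hφ : HasFrameMatrix c φ A) (hψ : HasFrameMatrix c ψ B) :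
    HasFrameMatrix c (φ ∘ ψ) (B * A) := by
  intro i x
  rw [frameMap_comp hφs hψs, hψ, frameMap_sum]
  simp only [hφ _ _, mul_apply, Finset.sum_smul, Finset.smul_sum, smul_smul]
  rw [Finset.sum_comm]

lemma hasFrameMatrix_id (c : Fin 3 → ℝ) : HasFrameMatrix c id 1 := by
  intro i x
  rw [frameMap_id]
  simp [one_apply]

lemma HasFrameMatrix.rescale {c : Fin 3 → ℝ} (hc : ∀ i, c i ≠ 0) {φ : SLTilde → SLTilde}
    {A : Matrix (Fin 3) (Fin 3) ℝ} (hA : ∀ i j, c i * A i j = c j * A i j)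
    (hφ : HasFrameMatrix c φ A) : HasFrameMatrix (fun _ => 1) φ A := by
  intro i x
  have e : ∀ i, scaledBasis c i = c i • scaledBasis (fun _ => 1) i := fun i => by
    simp [scaledBasis]
  have h := hφ i x
  rw [e, frameMap_smul] at h
  have h2 : ∑ j, A i j • scaledBasis c j = c i • ∑ j, A i j • scaledBasis (fun _ => 1) j := by
    rw [Finset.smul_sum]
    exact Finset.sum_congr rfl fun j _ => by rw [e, smul_smul, smul_smul, hA, mul_comm]
  rw [h2] at h
  exact smul_right_injective _ (hc i) h

/-- Two diffeomorphisms with the same constant differential differ by a left translation. -/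
lemma mem_of_hasFrameMatrix {c : Fin 3 → ℝ} (hc : ∀ i, c i ≠ 0) (H : Subgroup DiffeoSL)
    (hH : ∀ a, leftTranslation a ∈ H) {φ ψ : DiffeoSL} {A : Matrix (Fin 3) (Fin 3) ℝ}
    (hφ : HasFrameMatrix c φ A) (hψ : HasFrameMatrix c ψ A) (hm : ψ ∈ H) : φ ∈ H := by
  have hs : ∀ χ : DiffeoSL, ContMDiff modelSL modelSL ∞ χ := fun χ => χ.contMDiff
  have h1 : ∀ v x, frameMap (φ * ψ⁻¹ : DiffeoSL) v x = v := by
    intro v x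
    have e1 : (⇑(φ * ψ⁻¹ : DiffeoSL)) = φ ∘ (ψ⁻¹ : DiffeoSL) := rfl
    have e2 : ψ ∘ (ψ⁻¹ : DiffeoSL) = id := funext fun y => ψ.apply_symm_apply y
    rw [e1, frameMap_comp (hs φ) (hs ψ⁻¹), hφ.frameMap_eq hc hψ _ _ ((ψ⁻¹ : DiffeoSL) x),
      ← frameMap_comp (hs ψ) (hs ψ⁻¹), e2, frameMap_id]
  have h2 : φ * ψ⁻¹ = leftTranslation ((φ * ψ⁻¹ : DiffeoSL) 1) :=
    Diffeomorph.ext fun x => eq_leftMul_of_frameMap_eq (hs (φ * ψ⁻¹)) h1 x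
  have h3 : φ = φ * ψ⁻¹ * ψ := (inv_mul_cancel_right φ ψ).symm
  rw [h3, h2]
  exact H.mul_mem (hH _) hm

/-! ### Automorphisms -/

lemma stdFrame_eq (i : Fin 3) (x : SLTilde) :
    stdFrame i x = leftField (scaledBasis (fun _ => 1) i) x := by
  have h : scaledBasis (fun _ => 1) i = stdBasis i := one_smul ℝ _
  rw [h]
  exact mulInvariantVectorField_eq (stdBasis i) x

lemma frameMap_eq_frameMap_one {ψ : DiffeoSL} (h : ∀ x y, ψ (x * y) = ψ x * ψ y) (v : ℝ × ℂ)
    (x : SLTilde) : frameMap ψ v x = frameMap ψ v 1 := by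
  have e : ψ ∘ (fun y => x * y) = (fun y => ψ x * y) ∘ ψ := funext (h x)
  have h1 := frameMap_comp ψ.contMDiff (contMDiff_leftMul x) v 1
  rw [e, frameMap_comp (contMDiff_leftMul _) ψ.contMDiff, frameMap_leftMul, frameMap_leftMul,
    mul_one] at h1
  exact h1.symm

/-- The differential of an automorphism is constant in the left invariant trivialisation. -/
lemma isAutomorphismWith_iff {A : Matrix (Fin 3) (Fin 3) ℝ} {ψ : DiffeoSL} :
    IsAutomorphismWith A ψ ↔
      (∀ x y, ψ (x * y) = ψ x * ψ y) ∧ HasFrameMatrix (fun _ => 1) ψ A := by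
  refine and_congr_right fun h => ?_
  have h1 : ∀ i, mfderiv modelSL modelSL ψ 1 (stdFrame i 1)
      = leftField (frameMap ψ (scaledBasis (fun _ => 1) i) 1) (ψ 1) := fun i => by
    have e : scaledBasis (fun _ => 1) i = stdBasis i := one_smul ℝ _
    rw [e]
    exact (mfderiv_mulInvariantVectorField ψ.contMDiff (stdBasis i) 1).trans
      (mulInvariantVectorField_eq (frameMap ψ (stdBasis i) 1 : LieSL) (ψ 1))
  have h2 : ∀ i, (∑ j, A i j • stdFrame j (ψ 1) : TangentSpace modelSL (ψ 1))
      = leftField (∑ j, A i j • scaledBasis (fun _ => 1) j) (ψ 1) := fun i => by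
    refine Eq.trans ?_ (leftField_sum (fun j => A i j) (scaledBasis fun _ => 1) _).symm
    exact Finset.sum_congr rfl fun j _ => congrArg (fun u : ℝ × ℂ => A i j • u)
      (stdFrame_eq j (ψ 1))
  constructor
  · intro hm i x
    have h3 := (h1 i).symm.trans ((hm i).trans (h2 i))
    have h4 := congrArg (coframe (ψ 1)) h3
    rw [coframe_leftField, coframe_leftField] at h4
    rw [frameMap_eq_frameMap_one h, h4]
  · intro hm i
    have h3 := h1 i
    rw [hm i 1] at h3
    exact h3.trans (h2 i).symm

/-- The diffeomorphism of `ℝ × D` induced by a linear automorphism of `ℝ × ℂ` which preserves the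
norm of the second component. -/
def ofLinear (L : (ℝ × ℂ) ≃L[ℝ] (ℝ × ℂ)) (h : ∀ p, ‖(L p).2‖ = ‖p.2‖) : DiffeoSL where
  toFun x := ⟨L x, (h x).trans_lt x.2⟩
  invFun x := ⟨L.symm x, by
    have := h (L.symm x)
    rw [L.apply_symm_apply] at this
    exact this.symm.trans_lt x.2⟩
  left_inv x := Subtype.ext (L.symm_apply_apply x)
  right_inv x := Subtype.ext (L.apply_symm_apply x)
  contMDiff_toFun := by
    rw [← ContMDiff.subtypeVal_comp_iff]
    exact L.contDiff.contMDiff.comp contMDiff_subtype_val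
  contMDiff_invFun := by
    rw [← ContMDiff.subtypeVal_comp_iff]
    exact L.symm.contDiff.contMDiff.comp contMDiff_subtype_val

lemma coe_ofLinear (L : (ℝ × ℂ) ≃L[ℝ] (ℝ × ℂ)) (h : ∀ p, ‖(L p).2‖ = ‖p.2‖) (x : SLTilde) :
    (ofLinear L h x : ℝ × ℂ) = L x := rfl

lemma frameMap_ofLinear_one (L : (ℝ × ℂ) ≃L[ℝ] (ℝ × ℂ)) (h : ∀ p, ‖(L p).2‖ = ‖p.2‖)
    (v : ℝ × ℂ) : frameMap (ofLinear L h) v 1 = L v := by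
  have h3 : ((incl ∘ ofLinear L h) ∘ retract) =ᶠ[nhds ((1 : SLTilde) : ℝ × ℂ)] L := by
    filter_upwards [lineTimesDisc_mem_nhds 1] with p hp
    simp only [Function.comp, incl, coe_ofLinear, coe_retract hp]
  have h1 : ofLinear L h 1 = 1 := Subtype.ext (map_zero L)
  have h4 : lieD v (incl ∘ ofLinear L h) 1 = leftField (L v) (1 : SLTilde) := by
    rw [lieD, h3.fderiv_eq, leftField_one, leftField_one, L.fderiv]
    rfl
  rw [frameMap, h1, h4, coframe_leftField]

lemma isAutomorphismWith_ofLinear (L : (ℝ × ℂ) ≃L[ℝ] (ℝ × ℂ)) (h : ∀ p, ‖(L p).2‖ = ‖p.2‖)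
    (hm : ∀ x y : SLTilde, L (mulAux x y) = mulAux (L x) (L y)) {A : Matrix (Fin 3) (Fin 3) ℝ}
    (hA : ∀ i, L (scaledBasis (fun _ => 1) i) = ∑ j, A i j • scaledBasis (fun _ => 1) j) :
    IsAutomorphismWith A (ofLinear L h) := by
  have hm' : ∀ x y, ofLinear L h (x * y) = ofLinear L h x * ofLinear L h y := fun x y =>
    Subtype.ext (hm x y)
  refine isAutomorphismWith_iff.2 ⟨hm', fun i x => ?_⟩
  rw [frameMap_eq_frameMap_one hm', frameMap_ofLinear_one, hA]

lemma conj_phase_mul_phase (a : ℝ) : conj (phase a) * phase a = 1 := by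
  rw [mul_comm, phase_mul_conj]

/-- The rotation `(α, z) ↦ (α, e^{iθ} z)`. -/
def rotEquiv (θ : ℝ) : (ℝ × ℂ) ≃L[ℝ] (ℝ × ℂ) :=
  (ContinuousLinearEquiv.refl ℝ ℝ).prodCongr
    ((ContinuousLinearEquiv.unitsEquivAut ℂ (Units.mk (phase θ) (conj (phase θ))
      (phase_mul_conj θ) (conj_phase_mul_phase θ))).restrictScalars ℝ)

lemma rotEquiv_apply (θ : ℝ) (p : ℝ × ℂ) : rotEquiv θ p = (p.1, phase θ * p.2) :=
  Prod.ext rfl (mul_comm _ _)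

/-- The reflection `(α, z) ↦ (-α, z̄)`. -/
def conjEquiv : (ℝ × ℂ) ≃L[ℝ] (ℝ × ℂ) :=
  (ContinuousLinearEquiv.neg ℝ).prodCongr Complex.conjCLE

lemma conjEquiv_apply (p : ℝ × ℂ) : conjEquiv p = (-p.1, conj p.2) := rfl

lemma phase_eq (θ : ℝ) : phase θ = ⟨Real.cos θ, Real.sin θ⟩ :=
  Complex.ext (Complex.exp_ofReal_mul_I_re θ) (Complex.exp_ofReal_mul_I_im θ)

lemma exists_isAutomorphismWith_rotMatrix (θ : ℝ) :
    ∃ ψ, IsAutomorphismWith (rotMatrix θ) ψ := by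
  have hn : ∀ p, ‖(rotEquiv θ p).2‖ = ‖p.2‖ := fun p => by
    rw [rotEquiv_apply, norm_mul, norm_phase, one_mul]
  refine ⟨ofLinear (rotEquiv θ) hn, isAutomorphismWith_ofLinear _ _ (fun x y => ?_) fun i => ?_⟩
  · have hd : den (rotEquiv θ x) (rotEquiv θ y).2 = den x (y : ℝ × ℂ).2 := by
      simp only [rotEquiv_apply, den, map_mul]
      linear_combination (conj (x : ℝ × ℂ).2 * phase (x : ℝ × ℂ).1 * (y : ℝ × ℂ).2)
        * conj_phase_mul_phase θ
    rw [mulAux, mulAux, mobius, mobius, hd]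
    simp only [rotEquiv_apply]
    refine Prod.ext rfl ?_
    change _ * (_ / _) = _ / _
    rw [mul_div_assoc']
    congr 1
    ring
  · rw [rotEquiv_apply, phase_eq]
    fin_cases i <;> refine Prod.ext ?_ (Complex.ext ?_ ?_) <;>
      simp [Fin.sum_univ_three, rotMatrix, scaledBasis, Complex.cos_ofReal_re,
        Complex.sin_ofReal_re]

lemma exists_isAutomorphismWith_flipMatrix_one : ∃ ψ, IsAutomorphismWith (flipMatrix 1) ψ := by
  have hn : ∀ p, ‖(conjEquiv p).2‖ = ‖p.2‖ := fun p => Complex.norm_conj _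
  refine ⟨ofLinear conjEquiv hn, isAutomorphismWith_ofLinear _ _ (fun x y => ?_) fun i => ?_⟩
  · have hd : den (conjEquiv x) (conjEquiv y).2 = conj (den x (y : ℝ × ℂ).2) := by
      simp [conjEquiv_apply, den, phase_neg]
    have ha : (conj (den x (y : ℝ × ℂ).2)).arg = -(den x (y : ℝ × ℂ).2).arg := by
      rw [Complex.arg_conj, if_neg]
      intro h
      have := den_re_pos (p := x) x.2 y.2
      have h2 := (Complex.arg_eq_pi_iff.1 h).1
      linarith
    rw [mulAux, mulAux, mobius, mobius, hd, ha]
    simp only [conjEquiv_apply, phase_neg]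
    refine Prod.ext ?_ ?_
    · change -(_ - _) = _
      ring
    · simp
  · rw [conjEquiv_apply]
    fin_cases i <;> refine Prod.ext ?_ (Complex.ext ?_ ?_) <;>
      simp [Fin.sum_univ_three, flipMatrix, scaledBasis, Complex.conj_ofNat, neg_div]

/-! ### Constant differentials and tensors -/

lemma HasFrameMatrix.atOne_frameMap_scaledBasis {c : Fin 3 → ℝ} {φ : SLTilde → SLTilde}
    {A : Matrix (Fin 3) (Fin 3) ℝ} (hA : HasFrameMatrix c φ A) {h : CovTensor} {t : Fin 3 → ℝ}
    (hh : ∀ i j, atOne h (scaledBasis c i) (scaledBasis c j) = if i = j then t i else 0)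
    (i j : Fin 3) (x : SLTilde) :
    atOne h (frameMap φ (scaledBasis c i) x) (frameMap φ (scaledBasis c j) x)
      = (A * diagonal t * Aᵀ) i j := by
  rw [hA, hA, atOne_sum]
  simp only [hh, mul_ite, mul_zero, Finset.sum_ite_eq, Finset.mem_univ, if_true]
  rw [mul_apply]
  simp only [mul_diagonal, transpose_apply]
  exact Finset.sum_congr rfl fun k _ => by ring

lemma HasFrameMatrix.preserves {c : Fin 3 → ℝ} (hc : ∀ i, c i ≠ 0) {φ : SLTilde → SLTilde}
    (hφ : ContMDiff modelSL modelSL ∞ φ) {A : Matrix (Fin 3) (Fin 3) ℝ}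
    (hA : HasFrameMatrix c φ A) {h : CovTensor} (hinv : IsLeftInvariant h) {t : Fin 3 → ℝ}
    (hh : ∀ i j, atOne h (scaledBasis c i) (scaledBasis c j) = if i = j then t i else 0)
    (hAt : A * diagonal t * Aᵀ = diagonal t) : Preserves φ h := by
  have key : ∀ (x : SLTilde) (v w : ℝ × ℂ),
      atOne h (frameMap φ v x) (frameMap φ w x) = atOne h v w := by
    intro x v w
    rw [← sum_scaledCoord hc v, ← sum_scaledCoord hc w, frameMap_sum, frameMap_sum, atOne_sum,
      atOne_sum]
    refine Finset.sum_congr rfl fun i _ => Finset.sum_congr rfl fun j _ => ?_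
    rw [hA.atOne_frameMap_scaledBasis hh, hAt, hh, diagonal_apply]
  intro x v w
  have hv : ∀ u : TangentSpace modelSL x,
      mulInvariantVectorField (coframe (x : ℝ × ℂ) u : LieSL) x = u := fun u =>
    (mulInvariantVectorField_eq _ x).trans (leftField_coframe x u)
  have h1 := key x (coframe (x : ℝ × ℂ) v) (coframe (x : ℝ × ℂ) w)
  have h2 := apply_mulInvariantVectorField hinv x (coframe (x : ℝ × ℂ) v : LieSL)
    (coframe (x : ℝ × ℂ) w : LieSL)
  have h3 := apply_mulInvariantVectorField hinv (φ x)
    (frameMap φ (coframe (x : ℝ × ℂ) v) x : LieSL) (frameMap φ (coframe (x : ℝ × ℂ) w) x : LieSL)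
  have e := fun u : LieSL => mfderiv_mulInvariantVectorField hφ u x
  have e1 := e (coframe (x : ℝ × ℂ) v)
  have e2 := e (coframe (x : ℝ × ℂ) w)
  rw [hv] at e1 e2 h2
  rw [hv] at h2
  rw [pullbackEval, e1, e2]
  exact h3.trans (h1.trans h2.symm)

lemma HasFrameMatrix.mul_diagonal_mul_transpose {c : Fin 3 → ℝ} {φ : SLTilde → SLTilde}
    (hφ : ContMDiff modelSL modelSL ∞ φ) {A : Matrix (Fin 3) (Fin 3) ℝ}
    (hA : HasFrameMatrix c φ A) {h : CovTensor} (hinv : IsLeftInvariant h) {t : Fin 3 → ℝ}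
    (hh : ∀ i j, atOne h (scaledBasis c i) (scaledBasis c j) = if i = j then t i else 0)
    (hp : Preserves φ h) : A * diagonal t * Aᵀ = diagonal t := by
  ext i j
  rw [← hA.atOne_frameMap_scaledBasis hh i j 1, atOne_frameMap hinv hφ hp, hh, diagonal_apply]

/-! ### Orthogonal matrices commuting with the connection coefficients -/

/-- An orthogonal matrix with `A M = ε M A`, `ε = det A` and `M = diagonal μ`, is block diagonal.
The orientation reversing case is excluded because `μ_0 ≠ -μ_j` for all `j`; then `A` commutes with
`M`, and `μ_0 ≠ μ_1, μ_2`. -/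
lemma orthogonal_block {A : Matrix (Fin 3) (Fin 3) ℝ} {ε : ℝ} {μ : Fin 3 → ℝ} (hA : A * Aᵀ = 1)
    (hε : ε ^ 2 = 1) (hdet : A.det = ε) (hM : ε • (A * diagonal μ * Aᵀ) = diagonal μ)
    (h0 : 0 < μ 0) (h01 : 0 < μ 0 + μ 1) (h02 : 0 < μ 0 + μ 2) (h1 : μ 1 < μ 0) (h2 : μ 2 < μ 0) :
    (∀ i j, μ i ≠ μ j → A i j = 0) ∧ A 0 1 = 0 ∧ A 0 2 = 0 ∧ A 1 0 = 0 ∧ A 2 0 = 0 ∧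
      A.det = 1 := by
  have hA' : Aᵀ * A = 1 := mul_eq_one_comm.1 hA
  have hcomm : ∀ i j, ε * (A i j * μ j) = μ i * A i j := by
    intro i j
    have h := congrArg (fun B => (B * A) i j) hM
    simpa [smul_mul_assoc, Matrix.mul_assoc, hA'] using h
  have hrow : A 0 0 * A 0 0 + A 0 1 * A 0 1 + A 0 2 * A 0 2 = 1 := by
    have h := congrFun (congrFun hA 0) 0
    simpa [mul_apply, Fin.sum_univ_three] using h
  have hε1 : ε = 1 := by
    rcases mul_self_eq_one_iff.1 ((sq ε).symm.trans hε) with h | h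
    · exact h
    · exfalso
      subst h
      have hz : ∀ j, 0 < μ 0 + μ j → A 0 j = 0 := fun j hj => by
        have := hcomm 0 j
        refine (mul_eq_zero.1 (?_ : (μ 0 + μ j) * A 0 j = 0)).resolve_left hj.ne'
        linear_combination -this
      rw [hz 0 (by linarith), hz 1 h01, hz 2 h02] at hrow
      norm_num at hrow
  subst hε1
  have hz : ∀ i j, μ i ≠ μ j → A i j = 0 := fun i j hij => by
    have := hcomm i j
    refine (mul_eq_zero.1 (?_ : (μ i - μ j) * A i j = 0)).resolve_left (sub_ne_zero.2 hij)
    linear_combination -this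
  exact ⟨hz, hz 0 1 h1.ne', hz 0 2 h2.ne', hz 1 0 h1.ne, hz 2 0 h2.ne, hdet⟩

lemma exists_rotMatrix_eq {A : Matrix (Fin 3) (Fin 3) ℝ} (hA : A * Aᵀ = 1) (hdet : A.det = 1)
    (h01 : A 0 1 = 0) (h02 : A 0 2 = 0) (h10 : A 1 0 = 0) (h20 : A 2 0 = 0) :
    ∃ θ, A = rotMatrix θ ∨ A = flipMatrix 1 * rotMatrix θ := by
  have e : ∀ i j, A i 0 * A j 0 + A i 1 * A j 1 + A i 2 * A j 2 = if i = j then 1 else 0 := by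
    intro i j
    have h := congrFun (congrFun hA i) j
    simpa [mul_apply, Fin.sum_univ_three, one_apply] using h
  have e00 : A 0 0 ^ 2 = 1 := by
    have := e 0 0
    simp only [h01, h02, if_true] at this
    linear_combination this
  have e11 : A 1 1 ^ 2 + A 1 2 ^ 2 = 1 := by
    have := e 1 1
    simp only [h10, if_true] at this
    linear_combination this
  have e12 : A 1 1 * A 2 1 + A 1 2 * A 2 2 = 0 := by
    have := e 1 2
    simp [h10] at this
    linear_combination this
  have ed : A 0 0 * (A 1 1 * A 2 2 - A 1 2 * A 2 1) = 1 := by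
    rw [det_fin_three, h01, h02] at hdet
    linear_combination hdet
  have hz : ‖(⟨A 1 1, A 1 2⟩ : ℂ)‖ = 1 := by
    rw [← sq_eq_sq₀ (norm_nonneg _) zero_le_one, ← Complex.normSq_eq_norm_sq,
      Complex.normSq_apply]
    linear_combination e11
  have hne : (⟨A 1 1, A 1 2⟩ : ℂ) ≠ 0 := norm_ne_zero_iff.1 (by rw [hz]; exact one_ne_zero)
  refine ⟨Complex.arg ⟨A 1 1, A 1 2⟩, ?_⟩
  have hcos : Real.cos (Complex.arg ⟨A 1 1, A 1 2⟩) = A 1 1 := by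
    rw [Complex.cos_arg hne, hz, div_one]
  have hsin : Real.sin (Complex.arg ⟨A 1 1, A 1 2⟩) = A 1 2 := by
    rw [Complex.sin_arg, hz, div_one]
  rcases mul_self_eq_one_iff.1 ((sq _).symm.trans e00) with h | h
  · left
    rw [h, one_mul] at ed
    have h22 : A 2 2 = A 1 1 := by
      linear_combination A 1 1 * ed + A 1 2 * e12 - A 2 2 * e11
    have h21 : A 2 1 = -A 1 2 := by
      linear_combination -A 1 2 * ed + A 1 1 * e12 - A 2 1 * e11
    ext i j
    fin_cases i <;> fin_cases j <;> simp [rotMatrix, *]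
  · right
    rw [h] at ed
    have h22 : A 2 2 = -A 1 1 := by
      linear_combination -A 1 1 * ed + A 1 2 * e12 - A 2 2 * e11
    have h21 : A 2 1 = A 1 2 := by
      linear_combination A 1 2 * ed + A 1 1 * e12 - A 2 1 * e11
    ext i j
    fin_cases i <;> fin_cases j <;> simp [rotMatrix, flipMatrix, *]

lemma eq_one_or_flipMatrix {A : Matrix (Fin 3) (Fin 3) ℝ} (hA : A * Aᵀ = 1) (hdet : A.det = 1)
    (hd : ∀ i j, i ≠ j → A i j = 0) : A = 1 ∨ ∃ i, A = flipMatrix i := by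
  obtain ⟨d, rfl⟩ : ∃ d, A = diagonal d := ⟨fun i => A i i, by
    ext i j
    rw [diagonal_apply]
    split
    · next h => rw [h]
    · next h => exact hd i j h⟩
  have hsq : ∀ i, d i = 1 ∨ d i = -1 := fun i => by
    have h := congrFun (congrFun hA i) i
    rw [diagonal_transpose, diagonal_mul_diagonal, diagonal_apply_eq, one_apply_eq] at h
    exact mul_self_eq_one_iff.1 h
  rw [det_diagonal, Fin.prod_univ_three] at hdet
  have h3 : ∀ e : Fin 3 → ℝ, d 0 = e 0 → d 1 = e 1 → d 2 = e 2 → d = e := fun e h0 h1 h2 => by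
    ext i
    fin_cases i
    exacts [h0, h1, h2]
  rcases hsq 0 with h0 | h0 <;> rcases hsq 1 with h1 | h1 <;> rcases hsq 2 with h2 | h2 <;>
    rw [h0, h1, h2] at hdet <;> norm_num at hdet
  · left
    rw [h3 (fun _ => 1) h0 h1 h2, diagonal_one]
  · exact Or.inr ⟨0, congrArg diagonal (h3 _ h0 h1 h2)⟩
  · exact Or.inr ⟨1, congrArg diagonal (h3 _ h0 h1 h2)⟩
  · exact Or.inr ⟨2, congrArg diagonal (h3 _ h0 h1 h2)⟩

/-! ### The two groups -/

lemma leftTranslation_mem_groupDs (a : SLTilde) : leftTranslation a ∈ groupDs :=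
  Subgroup.subset_closure (Or.inl ⟨a, rfl⟩)

lemma groupDs_le_groupDe : groupDs ≤ groupDe := fun _ h => Subgroup.subset_closure (Or.inl h)

lemma flipMatrix_zero : flipMatrix 0 = rotMatrix Real.pi := by
  ext i j
  fin_cases i <;> fin_cases j <;> simp [flipMatrix, rotMatrix]

lemma flipMatrix_two : flipMatrix 2 = flipMatrix 0 * flipMatrix 1 := by
  rw [flipMatrix, flipMatrix, flipMatrix, diagonal_mul_diagonal]
  congr 1
  ext i
  fin_cases i <;> simp

/-- Each sign change is realised in `𝒟_s`; the sign changes `0` and `1` come from `(α, z) ↦ (α, -z)`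
and `(α, z) ↦ (-α, z̄)`. -/
lemma exists_mem_groupDs (i : Fin 3) :
    ∃ ψ ∈ groupDs, HasFrameMatrix (fun _ => 1) ψ (flipMatrix i) := by
  have hmem : ∀ i ψ, IsAutomorphismWith (flipMatrix i) ψ →
      ∃ ψ ∈ groupDs, HasFrameMatrix (fun _ => 1) ψ (flipMatrix i) := fun i ψ h =>
    ⟨ψ, Subgroup.subset_closure (Or.inr ⟨i, h⟩), (isAutomorphismWith_iff.1 h).2⟩
  have h0 : ∃ ψ ∈ groupDs, HasFrameMatrix (fun _ => 1) ψ (flipMatrix 0) := by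
    obtain ⟨ψ, h⟩ := exists_isAutomorphismWith_rotMatrix Real.pi
    exact hmem 0 ψ (by rwa [flipMatrix_zero])
  have h1 : ∃ ψ ∈ groupDs, HasFrameMatrix (fun _ => 1) ψ (flipMatrix 1) := by
    obtain ⟨ψ, h⟩ := exists_isAutomorphismWith_flipMatrix_one
    exact hmem 1 ψ h
  have h2 : ∃ ψ ∈ groupDs, HasFrameMatrix (fun _ => 1) ψ (flipMatrix 2) := by
    obtain ⟨ψ, hψ, hA⟩ := h0
    obtain ⟨χ, hχ, hB⟩ := h1
    refine ⟨χ * ψ, groupDs.mul_mem hχ hψ, ?_⟩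
    rw [flipMatrix_two]
    exact hB.comp χ.contMDiff ψ.contMDiff hA
  fin_cases i
  exacts [h0, h1, h2]

lemma mem_groupDs_of_hasFrameMatrix {φ : DiffeoSL} {A : Matrix (Fin 3) (Fin 3) ℝ}
    (hφ : HasFrameMatrix (fun _ => 1) φ A) (hA : A = 1 ∨ ∃ i, A = flipMatrix i) :
    φ ∈ groupDs := by
  have h1 : ∀ _ : Fin 3, (1 : ℝ) ≠ 0 := fun _ => one_ne_zero
  rcases hA with rfl | ⟨i, rfl⟩
  · exact mem_of_hasFrameMatrix h1 groupDs leftTranslation_mem_groupDs hφ (ψ := 1)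
      (hasFrameMatrix_id _) groupDs.one_mem
  · obtain ⟨ψ, hψ, hB⟩ := exists_mem_groupDs i
    exact mem_of_hasFrameMatrix h1 groupDs leftTranslation_mem_groupDs hφ hB hψ

lemma mem_groupDe_of_hasFrameMatrix {φ : DiffeoSL} {A : Matrix (Fin 3) (Fin 3) ℝ}
    (hφ : HasFrameMatrix (fun _ => 1) φ A)
    (hA : ∃ θ, A = rotMatrix θ ∨ A = flipMatrix 1 * rotMatrix θ) : φ ∈ groupDe := by
  have h1 : ∀ _ : Fin 3, (1 : ℝ) ≠ 0 := fun _ => one_ne_zero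
  have hl : ∀ a, leftTranslation a ∈ groupDe := fun a =>
    groupDs_le_groupDe (leftTranslation_mem_groupDs a)
  obtain ⟨θ, hA⟩ := hA
  obtain ⟨ψ, hψ⟩ := exists_isAutomorphismWith_rotMatrix θ
  have hm : ψ ∈ groupDe := Subgroup.subset_closure (Or.inr ⟨θ, hψ⟩)
  have hB := (isAutomorphismWith_iff.1 hψ).2
  rcases hA with rfl | rfl
  · exact mem_of_hasFrameMatrix h1 groupDe hl hφ hB hm
  · obtain ⟨χ, hχ, hC⟩ := exists_mem_groupDs 1
    exact mem_of_hasFrameMatrix h1 groupDe hl hφ (ψ := ψ * χ)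
      (hB.comp ψ.contMDiff χ.contMDiff hC) (groupDe.mul_mem hm (groupDs_le_groupDe hχ))

/-! ### Diagonal tensors -/

/-- The diagonal components of a tensor with respect to the rescaled frame. -/
def diagAtOne (c : Fin 3 → ℝ) (h : CovTensor) (i : Fin 3) : ℝ :=
  atOne h (scaledBasis c i) (scaledBasis c i)

lemma IsDiagonal.atOne_scaledBasis {h : CovTensor} (hd : IsDiagonal h) (c : Fin 3 → ℝ)
    (i j : Fin 3) :
    atOne h (scaledBasis c i) (scaledBasis c j) = if i = j then diagAtOne c h i else 0 := by
  split
  · next hij => rw [hij]; rfl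
  · next hij =>
    have h1 := hd 1 i j hij
    have e : ∀ i, stdFrame i 1 = scaledBasis (fun _ => 1) i := fun i =>
      (stdFrame_eq i 1).trans (leftField_one _)
    have h2 : atOne h (scaledBasis (fun _ => 1) i) (scaledBasis (fun _ => 1) j) = 0 := by
      rw [e, e] at h1
      exact h1
    have e2 : ∀ i, scaledBasis c i = c i • scaledBasis (fun _ => 1) i := fun i => by
      simp [scaledBasis]
    rw [e2, e2, map_smul, map_smul, _root_.smul_apply, h2]
    simp

lemma flipMatrix_mul_diagonal (i : Fin 3) (t : Fin 3 → ℝ) :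
    flipMatrix i * diagonal t * (flipMatrix i)ᵀ = diagonal t := by
  rw [flipMatrix, diagonal_transpose, diagonal_mul_diagonal, diagonal_mul_diagonal]
  congr 1
  ext j
  split <;> ring

lemma rotMatrix_mul_diagonal (θ : ℝ) {t : Fin 3 → ℝ} (ht : t 1 = t 2) :
    rotMatrix θ * diagonal t * (rotMatrix θ)ᵀ = diagonal t := by
  have h := Real.sin_sq_add_cos_sq θ
  ext i j
  rw [mul_apply]
  simp only [mul_diagonal, transpose_apply, Fin.sum_univ_three, diagonal_apply, ht]
  fin_cases i <;> fin_cases j <;> simp [rotMatrix, ht]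
  · linear_combination t 2 * h
  · ring
  · ring
  · linear_combination t 2 * h

lemma groupDs_le_isometryGroup {g : MetricSL} {k : CovTensor} (hg : IsLeftInvariant g.inner)
    (hk : IsLeftInvariant k) (hgd : IsDiagonal g.inner) (hkd : IsDiagonal k) :
    groupDs ≤ isometryGroup g k := by
  refine (Subgroup.closure_le _).2 ?_
  rintro _ (⟨a, rfl⟩ | ⟨i, hi⟩)
  · exact ⟨hg a, hk a⟩
  · have hA := (isAutomorphismWith_iff.1 hi).2
    exact ⟨hA.preserves (fun _ => one_ne_zero) (Diffeomorph.contMDiff _) hg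
        (IsDiagonal.atOne_scaledBasis hgd _) (flipMatrix_mul_diagonal _ _),
      hA.preserves (fun _ => one_ne_zero) (Diffeomorph.contMDiff _) hk
        (IsDiagonal.atOne_scaledBasis hkd _) (flipMatrix_mul_diagonal _ _)⟩

lemma groupDe_le_isometryGroup {g : MetricSL} {k : CovTensor} (hg : IsLeftInvariant g.inner)
    (hk : IsLeftInvariant k) (hgd : IsDiagonal g.inner) (hkd : IsDiagonal k)
    (hg1 : diagAtOne (fun _ => 1) g.inner 1 = diagAtOne (fun _ => 1) g.inner 2)
    (hk1 : diagAtOne (fun _ => 1) k 1 = diagAtOne (fun _ => 1) k 2) :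
    groupDe ≤ isometryGroup g k := by
  refine (Subgroup.closure_le _).2 ?_
  rintro _ (h | ⟨θ, hθ⟩)
  · exact groupDs_le_isometryGroup hg hk hgd hkd h
  · have hA := (isAutomorphismWith_iff.1 hθ).2
    exact ⟨hA.preserves (fun _ => one_ne_zero) (Diffeomorph.contMDiff _) hg
        (IsDiagonal.atOne_scaledBasis hgd _) (rotMatrix_mul_diagonal _ hg1),
      hA.preserves (fun _ => one_ne_zero) (Diffeomorph.contMDiff _) hk
        (IsDiagonal.atOne_scaledBasis hkd _) (rotMatrix_mul_diagonal _ hk1)⟩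

lemma diagAtOne_eq (c : Fin 3 → ℝ) (h : CovTensor) (i : Fin 3) :
    diagAtOne c h i = c i ^ 2 * diagAtOne (fun _ => 1) h i := by
  have e2 : scaledBasis c i = c i • scaledBasis (fun _ => 1) i := by simp [scaledBasis]
  rw [diagAtOne, e2, map_smul, map_smul, _root_.smul_apply, smul_eq_mul, smul_eq_mul, diagAtOne]
  ring

/-! ### The matrix `n` of the rescaled basis -/

lemma structConst_eq {c : Fin 3 → ℝ} (hc : ∀ i, c i ≠ 0) (b : Module.Basis (Fin 3) ℝ LieSL)
    (hb : ∀ i, b i = c i • stdBasis i) (i k : Fin 3) :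
    structConst b i (i + 1) k = (if k = i + 2 then structN c (i + 2) else 0) ∧
      structConst b (i + 1) i k = -(if k = i + 2 then structN c (i + 2) else 0) := by
  have h1 : ∀ i, ⁅b i, b (i + 1)⁆ = structN c (i + 2) • b (i + 2) := fun i => by
    rw [hb, hb, hb]
    exact (bracket_eq _ _).trans (brk_scaledBasis hc i)
  have h2 : structConst b i (i + 1) k = (if k = i + 2 then structN c (i + 2) else 0) := by
    rw [structConst, h1, map_smul, Module.Basis.repr_self]
    simp [Finsupp.single_apply, eq_comm]
  refine ⟨h2, ?_⟩
  rw [← h2, structConst, structConst, ← lie_skew, map_neg]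
  rfl

lemma nMatrix_diag {c : Fin 3 → ℝ} (hc : ∀ i, c i ≠ 0) (b : Module.Basis (Fin 3) ℝ LieSL)
    (hb : ∀ i, b i = c i • stdBasis i) (i : Fin 3) : nMatrix b i i = structN c i := by
  have h := structConst_eq hc b hb
  have h0 : ∀ k, structConst b 0 1 k = _ ∧ structConst b 1 0 k = _ := h 0
  have h1 : ∀ k, structConst b 1 2 k = _ ∧ structConst b 2 1 k = _ := h 1
  have h2 : ∀ k, structConst b 2 0 k = _ ∧ structConst b 0 2 k = _ := h 2
  fin_cases i <;>
    simp [nMatrix, Fin.sum_univ_three, levi, det_fin_three, h0, h1, h2,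
      show (1 : Fin 3) + 2 = 0 from rfl, show (2 : Fin 3) + 2 = 1 from rfl] <;>
    ring

/-! ### The isometry group -/

/-- The differential of an element of `𝒟(g, k)` in the `g`-orthonormal frame. -/
lemma exists_hasFrameMatrix_of_mem {g : MetricSL} {k : CovTensor} (hg : IsLeftInvariant g.inner)
    (hk : IsLeftInvariant k) (hkd : IsDiagonal k) {c : Fin 3 → ℝ} (hc : ∀ i, 0 < c i)
    (horth : ∀ i j, atOne g.inner (scaledBasis c i) (scaledBasis c j) = if i = j then 1 else 0)
    {φ : DiffeoSL} (hφ : φ ∈ isometryGroup g k) :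
    ∃ A, HasFrameMatrix c φ A ∧ A * Aᵀ = 1 ∧ A.det = 1 ∧
      A 0 1 = 0 ∧ A 0 2 = 0 ∧ A 1 0 = 0 ∧ A 2 0 = 0 ∧
      ∀ i j, structN c i ≠ structN c j ∨ diagAtOne c k i ≠ diagAtOne c k j → A i j = 0 := by
  obtain ⟨A, ε, hA, hε, hdet, hM, hφA⟩ :=
    exists_const_frameMatrix hc hg horth φ.contMDiff hφ.1
  replace hφA : HasFrameMatrix c φ A := hφA
  have h0 := hc 0
  have h1 := hc 1
  have h2 := hc 2
  have n0 : structN c 0 < 0 := neg_neg_of_pos (by positivity)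
  have n1 : 0 < structN c 1 := by change 0 < c 2 * c 0 / c 1; positivity
  have n2 : 0 < structN c 2 := by change 0 < c 0 * c 1 / c 2; positivity
  have hμ : ∀ i, connCoeff c i = (structN c 0 + structN c 1 + structN c 2) / 2 - structN c i := by
    intro i
    fin_cases i <;> simp [connCoeff, show (1 : Fin 3) + 1 = 2 from rfl,
      show (1 : Fin 3) + 2 = 0 from rfl, show (2 : Fin 3) + 1 = 0 from rfl,
      show (2 : Fin 3) + 2 = 1 from rfl] <;> ring
  obtain ⟨hz, h01, h02, h10, h20, hdet1⟩ := orthogonal_block hA hε hdet hM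
    (connCoeff_zero_pos hc) (by rw [hμ, hμ]; linarith) (by rw [hμ, hμ]; linarith)
    (by rw [hμ, hμ]; linarith) (by rw [hμ, hμ]; linarith)
  refine ⟨A, hφA, hA, hdet1, h01, h02, h10, h20, fun i j hij => ?_⟩
  rcases hij with hij | hij
  · refine hz i j fun h => hij ?_
    rw [hμ, hμ] at h
    linarith
  · have hK := hφA.mul_diagonal_mul_transpose φ.contMDiff hk
      (IsDiagonal.atOne_scaledBasis hkd c) hφ.2
    have h := congrArg (fun B => (B * A) i j) hK
    rw [Matrix.mul_assoc, mul_eq_one_comm.1 hA, Matrix.mul_one, mul_diagonal, diagonal_mul] at h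
    refine (mul_eq_zero.1 (?_ : (diagAtOne c k i - diagAtOne c k j) * A i j = 0)).resolve_left
      (sub_ne_zero.2 hij)
    linear_combination -h

lemma isometryGroup_le_groupDs {g : MetricSL} {k : CovTensor} (hg : IsLeftInvariant g.inner)
    (hk : IsLeftInvariant k) (hkd : IsDiagonal k) {c : Fin 3 → ℝ} (hc : ∀ i, 0 < c i)
    (horth : ∀ i j, atOne g.inner (scaledBasis c i) (scaledBasis c j) = if i = j then 1 else 0)
    (hne : structN c 1 ≠ structN c 2 ∨ diagAtOne c k 1 ≠ diagAtOne c k 2) :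
    isometryGroup g k ≤ groupDs := by
  intro φ hφ
  obtain ⟨A, hφA, hA, hdet, h01, h02, h10, h20, hz⟩ :=
    exists_hasFrameMatrix_of_mem hg hk hkd hc horth hφ
  have h12 := hz 1 2 hne
  have h21 := hz 2 1 (hne.imp Ne.symm Ne.symm)
  have hd : ∀ i j, i ≠ j → A i j = 0 := by
    intro i j hij
    fin_cases i <;> fin_cases j <;> first | exact absurd rfl hij | assumption
  refine mem_groupDs_of_hasFrameMatrix (hφA.rescale (fun i => (hc i).ne') fun i j => ?_)
    (eq_one_or_flipMatrix hA hdet hd)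
  rcases eq_or_ne i j with rfl | hij
  · rfl
  · rw [hd i j hij, mul_zero, mul_zero]

lemma isometryGroup_le_groupDe {g : MetricSL} {k : CovTensor} (hg : IsLeftInvariant g.inner)
    (hk : IsLeftInvariant k) (hkd : IsDiagonal k) {c : Fin 3 → ℝ} (hc : ∀ i, 0 < c i)
    (horth : ∀ i j, atOne g.inner (scaledBasis c i) (scaledBasis c j) = if i = j then 1 else 0)
    (h12 : c 1 = c 2) : isometryGroup g k ≤ groupDe := by
  intro φ hφ
  obtain ⟨A, hφA, hA, hdet, h01, h02, h10, h20, -⟩ :=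
    exists_hasFrameMatrix_of_mem hg hk hkd hc horth hφ
  refine mem_groupDe_of_hasFrameMatrix (hφA.rescale (fun i => (hc i).ne') fun i j => ?_)
    (exists_rotMatrix_eq hA hdet h01 h02 h10 h20)
  fin_cases i <;> fin_cases j <;> simp [h01, h02, h10, h20, h12]

lemma structN_one_eq_two_iff {c : Fin 3 → ℝ} (hc : ∀ i, 0 < c i) :
    structN c 1 = structN c 2 ↔ c 1 = c 2 := by
  have h0 := hc 0
  have h1 := hc 1
  have h2 := hc 2
  change c 2 * c 0 / c 1 = c 0 * c 1 / c 2 ↔ _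
  rw [div_eq_div_iff h1.ne' h2.ne']
  constructor
  · intro h
    have h3 : c 0 * (c 1 + c 2) * (c 1 - c 2) = 0 := by linear_combination -h
    exact sub_eq_zero.1 ((mul_eq_zero.1 h3).resolve_left (by positivity))
  · intro h
    rw [h]; ring

end SLTilde

end

open SLTilde in
theorem mainTheorem6
    (g : MetricSL) (k : CovTensor)
    (hg : IsLeftInvariant g.inner) (hk : IsLeftInvariant k) (hks : IsSymmTensor k)
    (hcon : SatisfiesConstraints g k)
    (hgd : IsDiagonal g.inner) (hkd : IsDiagonal k)
    (c : Fin 3 → ℝ) (hc : ∀ i, 0 < c i)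
    (b : Module.Basis (Fin 3) ℝ LieSL) (hb : ∀ i, b i = c i • stdBasis i)
    (horth : ∀ i j, g.inner 1 (b i) (b j) = if i = j then 1 else 0) :
    ((nMatrix b 1 1 = nMatrix b 2 2 ∧ k 1 (b 1) (b 1) = k 1 (b 2) (b 2)) →
      isometryGroup g k = groupDe) ∧
    (¬ (nMatrix b 1 1 = nMatrix b 2 2 ∧ k 1 (b 1) (b 1) = k 1 (b 2) (b 2)) →
      isometryGroup g k = groupDs) := by
  have hc0 : ∀ i, c i ≠ 0 := fun i => (hc i).ne'
  have hbs : ∀ i, b i = scaledBasis c i := hb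
  have horth' : ∀ i j, atOne g.inner (scaledBasis c i) (scaledBasis c j)
      = if i = j then 1 else 0 := fun i j => by
    rw [← horth, hbs, hbs]
    rfl
  have hkb : ∀ i, k 1 (b i) (b i) = diagAtOne c k i := fun i => by
    rw [hbs]
    rfl
  rw [nMatrix_diag hc0 b hb, nMatrix_diag hc0 b hb, hkb, hkb]
  constructor
  · rintro ⟨hn, hk12⟩
    have h12 := (structN_one_eq_two_iff hc).1 hn
    have hg12 : diagAtOne c g.inner 1 = diagAtOne c g.inner 2 := by
      rw [diagAtOne, diagAtOne, horth', horth', if_pos rfl, if_pos rfl]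
    rw [diagAtOne_eq, diagAtOne_eq c _ 2, h12] at hk12 hg12
    have h2 : c 2 ^ 2 ≠ 0 := pow_ne_zero 2 (hc0 2)
    exact le_antisymm (isometryGroup_le_groupDe hg hk hkd hc horth' h12)
      (groupDe_le_isometryGroup hg hk hgd hkd (mul_left_cancel₀ h2 hg12)
        (mul_left_cancel₀ h2 hk12))
  · intro hne
    exact le_antisymm (isometryGroup_le_groupDs hg hk hkd hc horth' (not_and_or.1 hne))
      (groupDs_le_isometryGroup hg hk hgd hkd)
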